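/- Let $X$ be a real reflexive separable Banach space, $m\ge 1$, and let $g:X\times\mathbb{R}^m\to\mathbb{R}$ be locally Lipschitzian in both arguments simultaneously and convex in the second argument. Let $\xi\sim\mathcal N(0,R)$ be an $m$-dimensional Gaussian random vector, where $R=LL^{T}$ is a positive definite correlation matrix, and put $$\varphi(x):=\mathbb{P}\big(g(x,\xi)\le 0\big),\qquad e(x,v):=\mu_\eta\big(\{r\ge 0\mid g(x,rLv)\le 0\}\big)\quad (x\in X,\ v\in\mathbb{S}^{m-1}),$$ where $\mu_\eta$ is the Chi-distribution with $m$ degrees of freedom and $\mu_\zeta$ denotes the uniform distribution on the unit sphere $\mathbb{S}^{m-1}$. For $f:X\to\mathbb{R}$ let $f^\circ(x;h):=\limsup_{y\to x,\,t\downarrow 0}\frac{f(y+th)-f(y)}{t}$ be Clarke's directional derivative and $\partial^C f(x):=\{x^*\in X^*\mid \langle x^*,h\rangle\le f^\circ(x;h)\ \forall h\in X\}$ Clarke's subdifferential (for the locally Lipschitzian functions considered here); $\partial^C_x e(x,v)$ is the subdifferential of $e(\cdot,v)$ at $x$. Call $f$ strictly differentiable at $x$ with $\nabla f(x)=p\in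 X^*$ if $\frac{f(y+th)-f(y)}{t}\to\langle p,h\rangle$ as $y\to x$, $t\downarrow 0$, uniformly for $h$ in compact sets (Clarke's sense). Fix $x\in X$ with $g(x,0)<0$, and assume that either $\{z\in\mathbb{R}^m\mid g(x,z)\le 0\}$ is bounded, or there is some $l>0$ such that $$g^{\circ}(\cdot,z)(y;h)\le l\,\|z\|^{-m}e^{\|z\|^2/(2\|L\|^2)}\|h\|\qquad\forall h\in X,\ \forall y\in\mathbb{B}_{1/l}(x),\ \forall z\in\mathbb{R}^m \text{ with } \|z\|\ge l .$$ Assume in addition that $\partial^C_x e(x,v)$ is a singleton for $\mu_\zeta$-a.e. $v\in\mathbb{S}^{m-1}$. Then $e(\cdot,v)$ is strictly differentiable at $x$ for $\mu_\zeta$-a.e. $v$, the map $v\mapsto\nabla_x e(x,v)$ is Bochner integrable, $\varphi$ is strictly differentiable at $x$, and $$\nabla\varphi(x)=\int_{\mathbb{S}^{m-1}}\nabla_x e(x,v)\,d\mu_\zeta(v).$$ If moreover $X$ is finite-dimensional and there is a neighbourhood of $x$ at every point $y$ of which $\partial^C_x e(y,v)$ is a singleton for $\mu_\zeta$-a.e.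 $v$, then $\varphi$ is continuously differentiable in a neighbourhood of $x$. -/

import Mathlib

open MeasureTheory ProbabilityTheory Filter Topology Set

noncomputable section

namespace SphericRadial

section VariationalAnalysis

variable {X : Type*} [NormedAddCommGroup X] [NormedSpace ℝ X]

/-- Clarke's directional derivative
`f°(x; h) = limsup_{y → x, t ↓ 0} (f (y + t h) - f y) / t`, as an extended real number. -/
def clarkeDeriv (f : X → ℝ) (x h : X) : EReal :=
  limsup (fun p : X × ℝ => (((f (p.1 + p.2 • h) - f p.1) / p.2 : ℝ) : EReal))
    (𝓝 x ×ˢ 𝓝[>] (0 : ℝ))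

/-- Clarke's subdifferential of a locally Lipschitzian function:
`∂ᶜf(x) = {x* | ⟨x*, h⟩ ≤ f°(x; h) for all h}`. -/
def clarkeSubdiff (f : X → ℝ) (x : X) : Set (StrongDual ℝ X) :=
  {p | ∀ h : X, ((p h : ℝ) : EReal) ≤ clarkeDeriv f x h}

/-- `f` is strictly differentiable at `x` with derivative `p`, in the sense of Clarke (strict
Hadamard differentiability): `(f (y + t h) - f y) / t → ⟨p, h⟩` as `y → x` and `t ↓ 0`, uniformly
for `h` in compact sets. -/
def HasStrictDerivative (f : X → ℝ) (p : StrongDual ℝ X) (x : X) : Prop :=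
  ∀ K : Set X, IsCompact K →
    TendstoUniformlyOn (fun (q : X × ℝ) (h : X) => (f (q.1 + q.2 • h) - f q.1) / q.2)
      (fun h => p h) (𝓝 x ×ˢ 𝓝[>] (0 : ℝ)) K

/-- `f` is strictly differentiable at `x` in the sense of Clarke. -/
def StrictlyDifferentiableAt (f : X → ℝ) (x : X) : Prop :=
  ∃ p : StrongDual ℝ X, HasStrictDerivative f p x

open Classical in
/-- The gradient `∇f(x) ∈ X*` of a function that is strictly differentiable at `x` (and `0` if `f`
is not strictly differentiable at `x`). -/
def strictGradient (f : X → ℝ) (x : X) : StrongDual ℝ X :=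
  if h : StrictlyDifferentiableAt f x then h.choose else 0

end VariationalAnalysis

section Radial

/-- A (nonsingular) correlation matrix: positive definite with unit diagonal. -/
def IsCorrelationMatrix {m : ℕ} (R : Matrix (Fin m) (Fin m) ℝ) : Prop :=
  R.PosDef ∧ ∀ i, R i i = 1

/-- The density of the Chi-distribution with `m` degrees of freedom on `[0, ∞)`:
`χ(t) = K t ^ (m - 1) exp (-t² / 2)` with `K = 2 ^ (1 - m / 2) / Γ(m / 2)`. -/
def chiDensity (m : ℕ) (t : ℝ) : ℝ :=
  (2 : ℝ) ^ (1 - (m : ℝ) / 2) / Real.Gamma ((m : ℝ) / 2) * t ^ (m - 1) * Real.exp (-t ^ 2 / 2)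

/-- The Chi-distribution `μ_η` with `m` degrees of freedom. -/
def chiMeasure (m : ℕ) : Measure ℝ :=
  (volume.restrict (Ici (0 : ℝ))).withDensity (fun t => ENNReal.ofReal (chiDensity m t))

/-- The unit sphere of the Euclidean space `ℝᵐ`. -/
abbrev UnitSphere (m : ℕ) : Type := Metric.sphere (0 : EuclideanSpace ℝ (Fin m)) 1

/-- The uniform distribution `μ_ζ` on the unit sphere: the normalised surface measure. -/
def sphereUniform (m : ℕ) : Measure (UnitSphere m) :=
  let σ : Measure (UnitSphere m) := (volume : Measure (EuclideanSpace ℝ (Fin m))).toSphere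
  (σ univ)⁻¹ • σ

variable {X : Type*} {m : ℕ}

/-- The probability function `φ(x) = ℙ(g(x, ξ) ≤ 0)`. -/
def probFun {Ω : Type*} [MeasurableSpace Ω] (P : Measure Ω)
    (ξ : Ω → EuclideanSpace ℝ (Fin m)) (g : X → EuclideanSpace ℝ (Fin m) → ℝ) (x : X) : ℝ :=
  P.real {ω | g x (ξ ω) ≤ 0}

/-- The radial probability function `e(x, v) = μ_η {r ≥ 0 | g(x, r L v) ≤ 0}`. -/
def radialProb (g : X → EuclideanSpace ℝ (Fin m) → ℝ) (L : Matrix (Fin m) (Fin m) ℝ)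
    (x : X) (v : UnitSphere m) : ℝ :=
  (chiMeasure m).real
    {r | 0 ≤ r ∧ g x (r • Matrix.toEuclideanCLM (𝕜 := ℝ) L (v : EuclideanSpace ℝ (Fin m))) ≤ 0}

/-- The `l`-cone of nice directions `C_l(x)`; the norm of `L` is its Euclidean operator norm. -/
def niceCone [NormedAddCommGroup X] [NormedSpace ℝ X]
    (g : X → EuclideanSpace ℝ (Fin m) → ℝ) (L : Matrix (Fin m) (Fin m) ℝ) (l : ℝ) (x : X) :
    Set X :=
  {h | ∀ y ∈ Metric.closedBall x (1 / l), ∀ z : EuclideanSpace ℝ (Fin m), l ≤ ‖z‖ →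
    clarkeDeriv (fun x' => g x' z) y h ≤
      ((l * (‖z‖ ^ m)⁻¹ *
        Real.exp (‖z‖ ^ 2 / (2 * ‖Matrix.toEuclideanCLM (𝕜 := ℝ) L‖ ^ 2)) * ‖h‖ : ℝ) : EReal)}

end Radial

end SphericRadial

end

namespace SphericRadial

/-! ### Clarke derivatives and strict differentiability -/

section Variational

/-! In polar coordinates the Gaussian law splits into a uniform direction and an independent
Chi-distributed radius, so `φ` is the average of `e(·, v)` over the sphere
(`probFun_eq_integral_radialProb`). The theorem becomes differentiation under this integral, and the
crux is that near `x` all `e(·, v)` are Lipschitzian with one common constant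
(`exists_lipschitz_radialProb`).

That bound is proved ray by ray (`chiMeasure_real_sub_le`). Since `g(y, 0) ≤ -c` near `x`, convexity
forces growth at rate at least `c / r` beyond the radius `r` where a ray leaves the feasible set, so
a perturbation of `g` by `η` moves the exit radius by at most about `r η / c`. At bounded radii,
local Lipschitz continuity controls `η`. At large radii `s` the growth condition allows `η` of order
`s⁻ᵐ exp(s² / 2) ‖y - y'‖`; times `s` this is the reciprocal of the Chi-density up to a constant, so
the measure still changes by `O(‖y - y'‖)`. If the feasible set at `x` is bounded, exit radii near
`x` are bounded uniformly in `v` and no far estimate is needed.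

A singleton subdifferential makes Clarke's derivative linear by Hahn-Banach, hence the difference
quotients converge (`exists_tendsto_diffQuot_of_encard_eq_one`). Dominated convergence carries this
to the integral (`hasStrictDerivative_integral`); reflexivity and separability make `X*` separable,
so that the weak-* measurable gradient is Bochner measurable. In finite dimension the derivative is
strict in Fréchet's sense at all nearby points, which makes it continuous. -/

lemma eventually_snd_pos {Y : Type*} [TopologicalSpace Y] (x : Y) :
    ∀ᶠ q in 𝓝 x ×ˢ 𝓝[>] (0 : ℝ), 0 < q.2 :=
  tendsto_snd.eventually (eventually_mem_nhdsWithin)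

variable {X : Type*} [NormedAddCommGroup X] [NormedSpace ℝ X]

/-- The difference quotient `(f (y + t h) - f y) / t` at `q = (y, t)`. -/
noncomputable def diffQuot (f : X → ℝ) (h : X) (q : X × ℝ) : ℝ :=
  (f (q.1 + q.2 • h) - f q.1) / q.2

lemma tendsto_shift (x h : X) :
    Tendsto (fun q : X × ℝ => (q.1 + q.2 • h, q.2)) (𝓝 x ×ˢ 𝓝[>] (0 : ℝ))
      (𝓝 x ×ˢ 𝓝[>] (0 : ℝ)) := by
  refine Tendsto.prodMk ?_ tendsto_snd
  have h1 : Tendsto (fun q : X × ℝ => q.2) (𝓝 x ×ˢ 𝓝[>] (0 : ℝ)) (𝓝 0) :=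
    tendsto_snd.mono_right nhdsWithin_le_nhds
  have h2 : Tendsto (fun q : X × ℝ => q.1) (𝓝 x ×ˢ 𝓝[>] (0 : ℝ)) (𝓝 x) := tendsto_fst
  simpa using h2.add (h1.smul_const h)

lemma tendsto_scale {Y : Type*} [TopologicalSpace Y] (x : Y) {c : ℝ} (hc : 0 < c) :
    Tendsto (fun q : Y × ℝ => (q.1, c * q.2)) (𝓝 x ×ˢ 𝓝[>] (0 : ℝ))
      (𝓝 x ×ˢ 𝓝[>] (0 : ℝ)) := by
  refine Tendsto.prodMk tendsto_fst (tendsto_nhdsWithin_iff.2 ⟨?_, ?_⟩)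
  · have h1 : Tendsto (fun q : Y × ℝ => q.2) (𝓝 x ×ˢ 𝓝[>] (0 : ℝ)) (𝓝 0) :=
      tendsto_snd.mono_right nhdsWithin_le_nhds
    simpa using h1.const_mul c
  · filter_upwards [eventually_snd_pos x] with q hq using mul_pos hc hq

lemma eventually_shift_mem_ball {x : X} {δ : ℝ} (hδ : 0 < δ) (h : X) :
    ∀ᶠ q in 𝓝 x ×ˢ 𝓝[>] (0 : ℝ), q.1 ∈ Metric.ball x δ ∧ q.1 + q.2 • h ∈ Metric.ball x δ := by
  have h1 : Tendsto (fun q : X × ℝ => q.1) (𝓝 x ×ˢ 𝓝[>] (0 : ℝ)) (𝓝 x) := tendsto_fst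
  have h2 := tendsto_fst.comp (tendsto_shift x h)
  exact (h1.eventually (Metric.ball_mem_nhds x hδ)).and
    (h2.eventually (Metric.ball_mem_nhds x hδ))

variable {f : X → ℝ} {x : X} {C δ : ℝ}

lemma abs_diffQuot_le (hf : ∀ y ∈ Metric.ball x δ, ∀ y' ∈ Metric.ball x δ,
    |f y - f y'| ≤ C * ‖y - y'‖) {h : X} {q : X × ℝ} (hq : 0 < q.2)
    (h1 : q.1 ∈ Metric.ball x δ) (h2 : q.1 + q.2 • h ∈ Metric.ball x δ) :
    |diffQuot f h q| ≤ C * ‖h‖ := by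
  have := hf _ h2 _ h1
  rw [diffQuot, abs_div, abs_of_pos hq, div_le_iff₀ hq]
  simpa [norm_smul, abs_of_pos hq, mul_assoc, mul_comm, mul_left_comm] using this

lemma eventually_abs_diffQuot_le (hδ : 0 < δ) (hf : ∀ y ∈ Metric.ball x δ,
    ∀ y' ∈ Metric.ball x δ, |f y - f y'| ≤ C * ‖y - y'‖) (h : X) :
    ∀ᶠ q in 𝓝 x ×ˢ 𝓝[>] (0 : ℝ), |diffQuot f h q| ≤ C * ‖h‖ := by
  filter_upwards [eventually_snd_pos x, eventually_shift_mem_ball hδ h] with q hq h1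
  exact abs_diffQuot_le hf hq h1.1 h1.2

/-- For a locally Lipschitzian function, pointwise convergence of the difference quotients is
uniform on compact sets of directions. -/
theorem hasStrictDerivative_of_tendsto (hδ : 0 < δ) (hf : ∀ y ∈ Metric.ball x δ,
    ∀ y' ∈ Metric.ball x δ, |f y - f y'| ≤ C * ‖y - y'‖) {p : StrongDual ℝ X}
    (hp : ∀ h, Tendsto (diffQuot f h) (𝓝 x ×ˢ 𝓝[>] (0 : ℝ)) (𝓝 (p h))) :
    HasStrictDerivative f p x := by
  intro K hK
  rw [Metric.tendstoUniformlyOn_iff]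
  intro ε hε
  -- Replacing a direction by a net point at distance `r` costs at most `(|C| + ‖p‖) r ≤ ε / 2`; the
  -- `+ 1` keeps `M` positive.
  set M : ℝ := |C| + ‖p‖ + 1 with hM
  have hMpos : 0 < M := by positivity
  set r : ℝ := ε / (2 * M) with hr
  have hrpos : 0 < r := by positivity
  obtain ⟨t, -, htfin, htcov⟩ := hK.finite_cover_balls hrpos
  have hevt : ∀ᶠ q in 𝓝 x ×ˢ 𝓝[>] (0 : ℝ), ∀ k ∈ t, |p k - diffQuot f k q| < ε / 2 := by
    rw [eventually_all_finite htfin]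
    intro k _
    have := (Metric.tendsto_nhds.1 (hp k)) (ε / 2) (by positivity)
    filter_upwards [this] with q hq
    rwa [Real.dist_eq, abs_sub_comm] at hq
  obtain ⟨B, hB⟩ := hK.isBounded.exists_norm_le
  have hB' : ∀ h ∈ K, ‖h‖ ≤ |B| := fun h hh => (hB h hh).trans (le_abs_self B)
  have hball : ∀ᶠ q in 𝓝 x ×ˢ 𝓝[>] (0 : ℝ),
      ∀ h : X, ‖h‖ ≤ |B| + r → q.1 + q.2 • h ∈ Metric.ball x δ := by
    have h1 : Tendsto (fun q : X × ℝ => dist q.1 x + |q.2| * (|B| + r))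
        (𝓝 x ×ˢ 𝓝[>] (0 : ℝ)) (𝓝 0) := by
      have h1 : Tendsto (fun q : X × ℝ => |q.2|) (𝓝 x ×ˢ 𝓝[>] (0 : ℝ)) (𝓝 0) := by
        have : Tendsto (fun q : X × ℝ => q.2) (𝓝 x ×ˢ 𝓝[>] (0 : ℝ)) (𝓝 0) :=
          tendsto_snd.mono_right nhdsWithin_le_nhds
        simpa using this.abs
      have h2 : Tendsto (fun q : X × ℝ => dist q.1 x) (𝓝 x ×ˢ 𝓝[>] (0 : ℝ)) (𝓝 0) := by
        have : Tendsto (fun q : X × ℝ => q.1) (𝓝 x ×ˢ 𝓝[>] (0 : ℝ)) (𝓝 x) := tendsto_fst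
        exact tendsto_iff_dist_tendsto_zero.1 this
      simpa using h2.add (h1.mul_const (|B| + r))
    filter_upwards [h1.eventually (gt_mem_nhds hδ)] with q hq h hh
    rw [Metric.mem_ball]
    calc dist (q.1 + q.2 • h) x ≤ dist (q.1 + q.2 • h) q.1 + dist q.1 x := dist_triangle _ _ _
      _ = |q.2| * ‖h‖ + dist q.1 x := by simp [norm_smul]
      _ ≤ dist q.1 x + |q.2| * (|B| + r) := by
        rw [add_comm]; gcongr
      _ < δ := hq
  filter_upwards [hevt, hball, eventually_snd_pos x] with q h1 h2 h3 h hh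
  obtain ⟨k, hk, hkh⟩ := mem_iUnion₂.1 (htcov hh)
  rw [Metric.mem_ball, dist_eq_norm] at hkh
  have hkn : ‖k‖ ≤ |B| + r := by
    calc ‖k‖ = ‖h - (h - k)‖ := by simp
      _ ≤ ‖h‖ + ‖h - k‖ := norm_sub_le _ _
      _ ≤ |B| + r := add_le_add (hB' h hh) hkh.le
  have hhn : ‖h‖ ≤ |B| + r := (hB' h hh).trans (by linarith)
  have e1 : |diffQuot f k q - diffQuot f h q| ≤ |C| * r := by
    have := hf _ (h2 k hkn) _ (h2 h hhn)
    have e : diffQuot f k q - diffQuot f h q =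
        (f (q.1 + q.2 • k) - f (q.1 + q.2 • h)) / q.2 := by
      simp only [diffQuot]; ring
    rw [e, abs_div, abs_of_pos h3, div_le_iff₀ h3]
    calc _ ≤ C * ‖q.1 + q.2 • k - (q.1 + q.2 • h)‖ := this
      _ ≤ |C| * ‖q.1 + q.2 • k - (q.1 + q.2 • h)‖ := by gcongr; exact le_abs_self C
      _ = |C| * (q.2 * ‖h - k‖) := by
        rw [add_sub_add_left_eq_sub, ← smul_sub, norm_smul, Real.norm_eq_abs, abs_of_pos h3,
          norm_sub_rev]
      _ ≤ |C| * (q.2 * r) := by gcongr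
      _ = _ := by ring
  have e2 : |p h - p k| ≤ ‖p‖ * r := by
    rw [← map_sub]
    exact (p.le_opNorm _).trans (by gcongr)
  have e3 := h1 k hk
  rw [Real.dist_eq]
  change |p h - diffQuot f h q| < ε
  have e4 : (|C| + ‖p‖) * r ≤ ε / 2 := by
    have : M * r = ε / 2 := by rw [hr]; field_simp
    nlinarith
  calc |p h - diffQuot f h q|
      = |(p h - p k) + (p k - diffQuot f k q) + (diffQuot f k q - diffQuot f h q)| := by
        congr 1; ring
    _ ≤ |p h - p k| + |p k - diffQuot f k q| + |diffQuot f k q - diffQuot f h q| :=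
        abs_add_three _ _ _
    _ < ε := by linarith

lemma HasStrictDerivative.tendsto {p : StrongDual ℝ X} (hp : HasStrictDerivative f p x) (h : X) :
    Tendsto (diffQuot f h) (𝓝 x ×ˢ 𝓝[>] (0 : ℝ)) (𝓝 (p h)) :=
  (hp {h} isCompact_singleton).tendsto_at (mem_singleton h)

lemma HasStrictDerivative.unique {p p' : StrongDual ℝ X} (hp : HasStrictDerivative f p x)
    (hp' : HasStrictDerivative f p' x) : p = p' :=
  ContinuousLinearMap.ext fun h => tendsto_nhds_unique (hp.tendsto h) (hp'.tendsto h)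

lemma HasStrictDerivative.strictGradient_eq {p : StrongDual ℝ X}
    (hp : HasStrictDerivative f p x) : strictGradient f x = p := by
  have h : StrictlyDifferentiableAt f x := ⟨p, hp⟩
  rw [strictGradient, dif_pos h]
  exact h.choose_spec.unique hp

/-- For a function with bounded difference quotients near `x`, Clarke's derivative is a finite
number characterised by eventual bounds. -/
lemma exists_clarkeDeriv_eq_coe (hδ : 0 < δ) (hf : ∀ y ∈ Metric.ball x δ,
    ∀ y' ∈ Metric.ball x δ, |f y - f y'| ≤ C * ‖y - y'‖) (h : X) :
    ∃ N : ℝ, clarkeDeriv f x h = (N : EReal) ∧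
      (∀ c, N < c → ∀ᶠ q in 𝓝 x ×ˢ 𝓝[>] (0 : ℝ), diffQuot f h q < c) ∧
      (∀ c, (∀ᶠ q in 𝓝 x ×ˢ 𝓝[>] (0 : ℝ), diffQuot f h q ≤ c) → N ≤ c) := by
  have hb := eventually_abs_diffQuot_le hδ hf h
  have hle : ∀ c : ℝ, (∀ᶠ q in 𝓝 x ×ˢ 𝓝[>] (0 : ℝ), diffQuot f h q ≤ c) →
      clarkeDeriv f x h ≤ (c : EReal) := fun c hc =>
    limsup_le_of_le (h := hc.mono fun q hq => EReal.coe_le_coe_iff.2 hq)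
  have h1 : clarkeDeriv f x h ≤ ((C * ‖h‖ : ℝ) : EReal) :=
    hle _ (hb.mono fun q hq => (abs_le.1 hq).2)
  have h2 : ((-(C * ‖h‖) : ℝ) : EReal) ≤ clarkeDeriv f x h :=
    le_limsup_of_frequently_le
      (Eventually.frequently (hb.mono fun q hq => EReal.coe_le_coe_iff.2 (abs_le.1 hq).1))
  have ht : clarkeDeriv f x h ≠ ⊤ := fun e =>
    absurd (e ▸ h1) (not_le.2 (EReal.coe_lt_top _))
  have hbt : clarkeDeriv f x h ≠ ⊥ := fun e =>
    absurd (e ▸ h2) (not_le.2 (EReal.bot_lt_coe _))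
  refine ⟨(clarkeDeriv f x h).toReal, (EReal.coe_toReal ht hbt).symm, fun c hc => ?_,
    fun c hc => ?_⟩
  · have : clarkeDeriv f x h < (c : EReal) := by
      rw [← EReal.coe_toReal ht hbt]; exact EReal.coe_lt_coe_iff.2 hc
    exact (eventually_lt_of_limsup_lt this).mono fun q hq => EReal.coe_lt_coe_iff.1 hq
  · have := hle c hc
    rw [← EReal.coe_toReal ht hbt] at this
    exact EReal.coe_le_coe_iff.1 this

/-- A locally Lipschitzian function whose Clarke subdifferential is a singleton has convergent
difference quotients. -/
theorem exists_tendsto_diffQuot_of_encard_eq_one (hδ : 0 < δ) (hf : ∀ y ∈ Metric.ball x δ,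
    ∀ y' ∈ Metric.ball x δ, |f y - f y'| ≤ C * ‖y - y'‖)
    (h1 : (clarkeSubdiff f x).encard = 1) :
    ∃ p : StrongDual ℝ X, ∀ h, Tendsto (diffQuot f h) (𝓝 x ×ˢ 𝓝[>] (0 : ℝ)) (𝓝 (p h)) := by
  obtain ⟨p, hp⟩ := encard_eq_one.1 h1
  -- `N` is Clarke's derivative as a real function of the direction. It is shown to be sublinear,
  -- then equal to `p`.
  choose N hN hlt hle using exists_clarkeDeriv_eq_coe hδ hf
  have hNle : ∀ h, N h ≤ C * ‖h‖ := fun h =>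
    hle h _ ((eventually_abs_diffQuot_le hδ hf h).mono fun q hq => (abs_le.1 hq).2)
  have hadd : ∀ h k, N (h + k) ≤ N h + N k := by
    intro h k
    refine le_of_forall_pos_le_add fun ε hε => hle _ _ ?_
    -- Clarke's limsup also runs over base points, so the first increment may be measured from `y +
    -- t k`.
    filter_upwards [(tendsto_shift x k).eventually (hlt h (N h + ε / 2) (by linarith)),
      hlt k (N k + ε / 2) (by linarith)] with q ha hb
    have e : diffQuot f (h + k) q = diffQuot f h (q.1 + q.2 • k, q.2) + diffQuot f k q := by
      simp only [diffQuot]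
      rw [show q.1 + q.2 • (h + k) = q.1 + q.2 • k + q.2 • h by rw [smul_add]; abel]
      ring
    rw [e]; linarith
  have hsmul_le : ∀ c : ℝ, 0 < c → ∀ h, N (c • h) ≤ c * N h := by
    intro c hc h
    refine le_of_forall_pos_le_add fun ε hε => hle _ _ ?_
    filter_upwards [(tendsto_scale x hc).eventually
      (hlt h (N h + ε / c) (by linarith [div_pos hε hc])), eventually_snd_pos x] with q ha hq
    have e : diffQuot f (c • h) q = c * diffQuot f h (q.1, c * q.2) := by
      simp only [diffQuot]
      rw [smul_smul, mul_comm q.2 c]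
      field_simp
    rw [e]
    calc c * diffQuot f h (q.1, c * q.2) ≤ c * (N h + ε / c) := by gcongr
      _ = c * N h + ε := by field_simp
  have hsmul : ∀ c : ℝ, 0 < c → ∀ h, N (c • h) = c * N h := by
    intro c hc h
    refine le_antisymm (hsmul_le c hc h) ?_
    have := hsmul_le c⁻¹ (inv_pos.2 hc) (c • h)
    rw [inv_smul_smul₀ hc.ne', ← div_eq_inv_mul, le_div_iff₀ hc] at this
    linarith
  have hzero : N 0 = 0 := by
    have := hsmul 2 two_pos 0
    rw [smul_zero] at this
    linarith
  have hNp : ∀ h, N h = p h := by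
    intro h
    rcases eq_or_ne h 0 with rfl | hh
    · simp [hzero]
    -- Hahn-Banach: some linear functional below `N` touches `N` at `h`. It belongs to the
    -- subdifferential, so it is `p`.
    obtain ⟨G, hG1, hG2⟩ := exists_extension_of_le_sublinear
      (LinearPMap.mkSpanSingleton (K := ℝ) h (N h) hh) N hsmul hadd (by
        rintro ⟨z, hz⟩
        obtain ⟨c, rfl⟩ := Submodule.mem_span_singleton.1 hz
        rw [LinearPMap.mkSpanSingleton'_apply]
        simp only [smul_eq_mul, RingHom.id_apply]
        rcases lt_trichotomy c 0 with hc | hc | hc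
        · have e1 := hsmul (-c) (neg_pos.2 hc) h
          have e2 := hadd (c • h) ((-c) • h)
          rw [← add_smul, add_neg_cancel, zero_smul, hzero, e1] at e2
          linarith
        · simp [hc, hzero]
        · rw [hsmul c hc])
    have hGh : G h = N h := by
      have := hG1 ⟨h, Submodule.mem_span_singleton_self h⟩
      rw [this]
      exact LinearPMap.mkSpanSingleton'_apply_self ..
    let G' : StrongDual ℝ X := G.mkContinuous C fun z => by
      rw [Real.norm_eq_abs, abs_le]
      refine ⟨?_, (hG2 z).trans (hNle z)⟩
      have := (hG2 (-z)).trans (hNle (-z))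
      rw [map_neg, norm_neg] at this
      linarith
    have hmem : G' ∈ clarkeSubdiff f x := fun z => by
      rw [hN z]
      exact EReal.coe_le_coe_iff.2 (hG2 z)
    rw [hp, mem_singleton_iff] at hmem
    rw [← hGh, ← hmem]
    rfl
  refine ⟨p, fun h => Metric.tendsto_nhds.2 fun ε hε => ?_⟩
  -- The lower bound is the upper bound in direction `-h` from the base point `y + t h`, where the
  -- quotient changes sign.
  filter_upwards [hlt h (p h + ε) (by rw [hNp]; linarith),
    (tendsto_shift x h).eventually (hlt (-h) (-p h + ε) (by rw [hNp, map_neg]; linarith))]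
    with q ha hb
  have e : diffQuot f (-h) (q.1 + q.2 • h, q.2) = -diffQuot f h q := by
    simp only [diffQuot, smul_neg, add_neg_cancel_right]
    ring
  rw [e] at hb
  rw [Real.dist_eq, abs_lt]
  constructor <;> linarith

/-- Mean value inequality: a bound on Clarke's derivative on a convex set gives a Lipschitz
bound. -/
theorem sub_le_of_clarkeDeriv_le {S : Set X} (hS : Convex ℝ S) {M : ℝ} (hf : Continuous f)
    (hM : ∀ y ∈ S, ∀ h, clarkeDeriv f y h ≤ ((M * ‖h‖ : ℝ) : EReal))
    {a b : X} (ha : a ∈ S) (hb : b ∈ S) : f b - f a ≤ M * ‖b - a‖ := by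
  set h := b - a with hh
  have key := image_le_of_liminf_slope_right_le_deriv_boundary (a := 0) (b := 1)
    (f := fun s : ℝ => f (a + s • h)) (B := fun s => f a + s * (M * ‖h‖))
    (B' := fun _ => M * ‖h‖) (by fun_prop) (by simp) (by fun_prop)
    (fun s _ => by
      simpa using (((hasDerivAt_id s).mul_const (M * ‖h‖)).const_add (f a)).hasDerivWithinAt)
    (fun s hs r hr => by
      have hmem : a + s • h ∈ S := by
        have := hS.add_smul_sub_mem ha hb ⟨hs.1, hs.2.le⟩
        rwa [hh]
      have h1 : clarkeDeriv f (a + s • h) h < (r : EReal) :=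
        (hM _ hmem h).trans_lt (EReal.coe_lt_coe_iff.2 hr)
      have h2 := eventually_lt_of_limsup_lt h1
      -- Right slopes along the segment are difference quotients with frozen base point, hence
      -- dominated by the limsup.
      have h3 : Tendsto (fun z : ℝ => (a + s • h, z - s)) (𝓝[>] s)
          (𝓝 (a + s • h) ×ˢ 𝓝[>] (0 : ℝ)) := by
        refine Tendsto.prodMk tendsto_const_nhds (tendsto_nhdsWithin_iff.2 ⟨?_, ?_⟩)
        · have : Tendsto (fun z : ℝ => z - s) (𝓝 s) (𝓝 (s - s)) :=
            (continuous_id.sub continuous_const).tendsto s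
          rw [sub_self] at this
          exact this.mono_left nhdsWithin_le_nhds
        · filter_upwards [self_mem_nhdsWithin] with z hz
          exact mem_Ioi.2 (sub_pos.2 hz)
      refine Eventually.frequently ((h3.eventually h2).mono fun z hz => ?_)
      have := EReal.coe_lt_coe_iff.1 hz
      rw [slope_def_field]
      convert! this using 4
      simp only
      rw [add_assoc, ← add_smul]
      congr 2
      ring)
  have := key (right_mem_Icc.2 zero_le_one)
  simp only [one_smul, one_mul, hh, add_sub_cancel] at this
  linarith

/-- In finite dimension, Clarke's strict differentiability is strict Fréchet
differentiability. -/
theorem HasStrictDerivative.hasStrictFDerivAt [FiniteDimensional ℝ X] {p : StrongDual ℝ X}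
    (hp : HasStrictDerivative f p x) : HasStrictFDerivAt f p x := by
  have := FiniteDimensional.proper_real X
  rw [hasStrictFDerivAt_iff_isLittleO, Asymptotics.isLittleO_iff]
  intro ε hε
  -- The unit sphere is compact; an increment `q.1 - q.2` is its norm, used as step `t`, times a
  -- unit direction.
  have h := Metric.tendstoUniformlyOn_iff.1 (hp (Metric.sphere 0 1) (isCompact_sphere 0 1)) ε hε
  obtain ⟨U, hU, V, hV, hUV⟩ := mem_prod_iff.1 h
  obtain ⟨η, hη, hηV⟩ := Metric.mem_nhdsWithin_iff.1 hV
  have hd : ∀ᶠ q : X × X in 𝓝 (x, x), ‖q.1 - q.2‖ < η := by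
    have : ContinuousAt (fun q : X × X => ‖q.1 - q.2‖) (x, x) := by fun_prop
    exact this.eventually (gt_mem_nhds (by simpa using hη))
  have hU' : ∀ᶠ q : X × X in 𝓝 (x, x), q.2 ∈ U := continuousAt_snd.eventually hU
  filter_upwards [hd, hU'] with q h1 h2
  rcases eq_or_ne q.1 q.2 with e | e
  · simp [e]
  have hpos : 0 < ‖q.1 - q.2‖ := norm_pos_iff.2 (sub_ne_zero.2 e)
  have hv : ‖q.1 - q.2‖ ∈ V := hηV ⟨by simpa using h1, hpos⟩
  have hk := hUV (show (q.2, ‖q.1 - q.2‖) ∈ U ×ˢ V from ⟨h2, hv⟩)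
  have := hk (‖q.1 - q.2‖⁻¹ • (q.1 - q.2)) (by simp [norm_smul, hpos.ne'])
  simp only [smul_smul, mul_inv_cancel₀ hpos.ne', one_smul, add_sub_cancel, map_smul,
    smul_eq_mul, Real.dist_eq] at this
  have e3 : ‖q.1 - q.2‖⁻¹ * p (q.1 - q.2) - (f q.1 - f q.2) / ‖q.1 - q.2‖
      = -(f q.1 - f q.2 - p (q.1 - q.2)) / ‖q.1 - q.2‖ := by ring
  rw [e3, abs_div, abs_neg, abs_norm, div_lt_iff₀ hpos] at this
  exact this.le

/-- A function that is strictly Fréchet differentiable near a point is `C¹` there. -/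
theorem contDiffAt_one_of_eventually_hasStrictFDerivAt {f' : X → StrongDual ℝ X}
    (hf : ∀ᶠ y in 𝓝 x, HasStrictFDerivAt f (f' y) y) : ContDiffAt ℝ 1 f x := by
  obtain ⟨U, hU, hUo, hxU⟩ := eventually_nhds_iff.1 hf
  have hcont : ContinuousOn f' U := by
    intro y hy
    refine ContinuousAt.continuousWithinAt (Metric.continuousAt_iff'.2 fun ε hε => ?_)
    -- Near `y`, `f - f' y` is `ε / 2`-Lipschitz, so its derivative `f' z - f' y` at nearby `z` has
    -- norm at most `ε / 2`.
    obtain ⟨s, hs, hc⟩ := (hU y hy).approximates_deriv_on_nhds (c := ⟨ε / 2, by positivity⟩)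
      (Or.inr (NNReal.coe_pos.1 (half_pos hε)))
    filter_upwards [eventually_mem_nhds_iff.2 hs, hUo.mem_nhds hy] with z hz hzU
    have h1 := (hU z hzU).hasFDerivAt.sub (f' y).hasFDerivAt
    have h2 := h1.le_of_lipschitzOn hz hc.lipschitzOnWith
    rw [dist_eq_norm]
    exact h2.trans_lt (half_lt_self hε)
  exact contDiffAt_one_iff.2 ⟨f', U, hUo.mem_nhds hxU, hcont, fun y hy => (hU y hy).hasFDerivAt⟩

end Variational

/-! ### Separability of the dual and Pettis measurability -/

section DualMeasurability

variable {X : Type*} [NormedAddCommGroup X] [NormedSpace ℝ X]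

/-- A normed space with separable dual is separable. -/
theorem separableSpace_of_separableSpace_dual
    [TopologicalSpace.SeparableSpace (StrongDual ℝ X)] : TopologicalSpace.SeparableSpace X := by
  have hex : ∀ f : StrongDual ℝ X, ∃ z : X, ‖z‖ ≤ 1 ∧ ‖f‖ / 2 ≤ |f z| := by
    intro f
    rcases eq_or_ne f 0 with rfl | hf
    · exact ⟨0, by simp⟩
    have hpos : 0 < ‖f‖ := norm_pos_iff.2 hf
    obtain ⟨z, hz, hz'⟩ := f.exists_lt_apply_of_lt_opNorm (half_lt_self hpos)
    exact ⟨z, hz.le, hz'.le⟩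
  choose z hz1 hz2 using hex
  -- The near-norming vectors of a dense sequence of functionals span a dense subspace: a nonzero
  -- `f` vanishing on them would satisfy `‖f‖ ≤ 3 ‖f - D n‖ < ‖f‖` for a suitable `n`.
  let D := TopologicalSpace.denseSeq (StrongDual ℝ X)
  let W := Submodule.span ℝ (range fun n => z (D n))
  have hsep : TopologicalSpace.IsSeparable (W : Set X) :=
    (countable_range _).isSeparable.span
  suffices h : W.topologicalClosure = ⊤ by
    have : TopologicalSpace.IsSeparable (W.topologicalClosure : Set X) := hsep.closure
    rw [h] at this
    exact TopologicalSpace.isSeparable_univ_iff.1 this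
  by_contra hne
  obtain ⟨x₀, hx₀⟩ : ∃ x₀, x₀ ∉ W.topologicalClosure := by
    by_contra! hall
    exact hne (eq_top_iff.2 fun a _ => hall a)
  obtain ⟨f, u, hfx, hfW⟩ := geometric_hahn_banach_point_closed
    W.topologicalClosure.convex W.isClosed_topologicalClosure hx₀
  have hzero : ∀ w ∈ W, f w = 0 := by
    intro w hw
    by_contra hfw
    have h1 := hfW (((u - 1) / f w) • w)
      (W.le_topologicalClosure (W.smul_mem _ hw))
    rw [map_smul, smul_eq_mul, div_mul_cancel₀ _ hfw] at h1
    linarith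
  have hf : f ≠ 0 := by
    rintro rfl
    have h1 := hfW 0 (zero_mem _)
    simp only [zero_apply, map_zero] at hfx h1
    linarith
  have hpos : 0 < ‖f‖ := norm_pos_iff.2 hf
  obtain ⟨n, hn⟩ := (TopologicalSpace.denseRange_denseSeq (StrongDual ℝ X)).exists_dist_lt f
    (show 0 < ‖f‖ / 4 by positivity)
  rw [dist_eq_norm] at hn
  have h1 : f (z (D n)) = 0 := hzero _ (Submodule.subset_span ⟨n, rfl⟩)
  have h2 : |D n (z (D n))| ≤ ‖f - D n‖ := by
    have := (f - D n).le_of_opNorm_le le_rfl (z (D n))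
    rw [sub_apply, h1, zero_sub, norm_neg] at this
    exact this.trans (mul_le_of_le_one_right (norm_nonneg _) (hz1 _))
  have h3 : ‖f‖ ≤ ‖f - D n‖ + ‖D n‖ := by simpa using norm_add_le (f - D n) (D n)
  have h4 := hz2 (D n)
  change ‖f - D n‖ < _ at hn
  linarith

/-- The dual of a separable reflexive space is separable. -/
theorem separableSpace_dual_of_reflexive [TopologicalSpace.SeparableSpace X]
    (hrefl : Function.Surjective (NormedSpace.inclusionInDoubleDual ℝ X)) :
    TopologicalSpace.SeparableSpace (StrongDual ℝ X) := by
  have : TopologicalSpace.SeparableSpace (StrongDual ℝ (StrongDual ℝ X)) :=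
    hrefl.denseRange.separableSpace (NormedSpace.inclusionInDoubleDual ℝ X).continuous
  exact separableSpace_of_separableSpace_dual

/-- Pettis' theorem for maps into a separable dual: weak-* measurability suffices. -/
theorem stronglyMeasurable_dual [TopologicalSpace.SeparableSpace X]
    [TopologicalSpace.SeparableSpace (StrongDual ℝ X)] {α : Type*} [MeasurableSpace α]
    {p : α → StrongDual ℝ X} (hp : ∀ h, Measurable fun a => p a h) : StronglyMeasurable p := by
  borelize (StrongDual ℝ X)
  obtain ⟨d, hd⟩ := TopologicalSpace.exists_dense_seq X
  have hball : ∀ (q : StrongDual ℝ X) (r : ℝ), 0 < r →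
      MeasurableSet (p ⁻¹' Metric.closedBall q r) := by
    intro q r hr
    -- A dual norm bound needs testing only on a dense sequence, which leaves countably many scalar
    -- conditions.
    have e : p ⁻¹' Metric.closedBall q r = ⋂ n, {a | |p a (d n) - q (d n)| ≤ r * ‖d n‖} := by
      ext a
      simp only [mem_preimage, Metric.mem_closedBall, mem_iInter, mem_ofPred_eq, dist_eq_norm]
      refine ⟨fun h n => (p a - q).le_of_opNorm_le h (d n), fun h => ?_⟩
      refine ContinuousLinearMap.opNorm_le_bound _ hr.le fun y => ?_
      have hcl : IsClosed {y : X | ‖(p a - q) y‖ ≤ r * ‖y‖} :=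
        isClosed_le (by fun_prop) (by fun_prop)
      have hsub : range d ⊆ {y : X | ‖(p a - q) y‖ ≤ r * ‖y‖} := by
        rintro _ ⟨n, rfl⟩
        exact h n
      exact hcl.closure_subset_iff.2 hsub (hd y)
    rw [e]
    exact MeasurableSet.iInter fun n =>
      measurableSet_le (((hp _).sub_const _).abs) measurable_const
  refine (measurable_of_isOpen fun U hU => ?_).stronglyMeasurable
  obtain ⟨D, hDc, hDd⟩ := TopologicalSpace.exists_countable_dense (StrongDual ℝ X)
  have e : U = ⋃ q ∈ D, ⋃ n : ℕ, ⋃ (_ : Metric.closedBall q (1 / ((n : ℝ) + 1)) ⊆ U),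
      Metric.closedBall q (1 / ((n : ℝ) + 1)) := by
    refine Subset.antisymm (fun y hy => ?_) ?_
    · obtain ⟨ε, hε, hεU⟩ := Metric.isOpen_iff.1 hU y hy
      obtain ⟨n, hn⟩ := exists_nat_one_div_lt (half_pos hε)
      obtain ⟨q, hq, hqy⟩ := hDd.exists_dist_lt y (Nat.one_div_pos_of_nat (α := ℝ) (n := n))
      simp only [mem_iUnion]
      refine ⟨q, hq, n, fun w hw => hεU ?_, hqy.le⟩
      rw [Metric.mem_closedBall] at hw
      rw [Metric.mem_ball]
      have := dist_triangle w q y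
      rw [dist_comm q y] at this
      linarith
    · simp only [iUnion_subset_iff]
      exact fun _ _ _ h => h
  rw [e]
  simp only [preimage_iUnion]
  exact .biUnion hDc fun q _ => .iUnion fun n => .iUnion fun _ =>
    hball q _ (Nat.one_div_pos_of_nat)

end DualMeasurability

/-! ### Strict differentiation under the integral sign -/

section IntegralFunctional

variable {X : Type*} [NormedAddCommGroup X] [NormedSpace ℝ X] {V : Type*} [MeasurableSpace V]
  {μ : Measure V} {e : X → V → ℝ} {x : X} {C δ : ℝ}

lemma ae_hasStrictDerivative (hδ : 0 < δ)
    (hlip : ∀ v, ∀ y ∈ Metric.ball x δ, ∀ y' ∈ Metric.ball x δ,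
      |e y v - e y' v| ≤ C * ‖y - y'‖)
    (h1 : ∀ᵐ v ∂μ, (clarkeSubdiff (fun y => e y v) x).encard = 1) :
    ∀ᵐ v ∂μ, HasStrictDerivative (fun y => e y v) (strictGradient (fun y => e y v) x) x := by
  filter_upwards [h1] with v hv
  obtain ⟨p, hp⟩ := exists_tendsto_diffQuot_of_encard_eq_one hδ (hlip v) hv
  have := hasStrictDerivative_of_tendsto hδ (hlip v) hp
  rwa [this.strictGradient_eq]

lemma tendsto_const_one_div {Y : Type*} [TopologicalSpace Y] (x : Y) :
    Tendsto (fun n : ℕ => (x, 1 / ((n : ℝ) + 1))) atTop (𝓝 x ×ˢ 𝓝[>] (0 : ℝ)) :=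
  Tendsto.prodMk tendsto_const_nhds (tendsto_nhdsWithin_iff.2
    ⟨tendsto_one_div_add_atTop_nhds_zero_nat, .of_forall fun _ => mem_Ioi.2 Nat.one_div_pos_of_nat⟩)

lemma aestronglyMeasurable_strictGradient [TopologicalSpace.SeparableSpace X]
    [TopologicalSpace.SeparableSpace (StrongDual ℝ X)] (hmeas : ∀ y, Measurable (e y))
    (h : ∀ᵐ v ∂μ, HasStrictDerivative (fun y => e y v) (strictGradient (fun y => e y v) x) x) :
    AEStronglyMeasurable (fun v => strictGradient (fun y => e y v) x) μ := by
  set B := {v | ¬ HasStrictDerivative (fun y => e y v) (strictGradient (fun y => e y v) x) x}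
  -- The exceptional set `B` is not known to be measurable, so a measurable hull of it is removed.
  set G := (toMeasurable μ B)ᶜ
  have hGm : MeasurableSet G := (measurableSet_toMeasurable _ _).compl
  have hG : G ∈ ae μ := by
    rw [mem_ae_iff, compl_compl, measure_toMeasurable]
    exact h
  have hGs : ∀ v ∈ G,
      HasStrictDerivative (fun y => e y v) (strictGradient (fun y => e y v) x) x :=
    fun v hv => by_contra fun hvB => hv (subset_toMeasurable _ _ hvB)
  refine ⟨G.indicator fun v => strictGradient (fun y => e y v) x,
    stronglyMeasurable_dual fun k => ?_, ?_⟩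
  -- On `G` each `⟨∇e, k⟩` is a sequential limit of measurable difference quotients based at `x`.
  · refine measurable_of_tendsto_metrizable (f := fun (n : ℕ) =>
      G.indicator fun v => diffQuot (fun y => e y v) k (x, 1 / ((n : ℝ) + 1))) (fun n => ?_) ?_
    · exact (((hmeas _).sub (hmeas _)).div_const _).indicator hGm
    · rw [tendsto_pi_nhds]
      intro v
      by_cases hv : v ∈ G
      · simp only [indicator_of_mem hv]
        exact ((hGs v hv).tendsto k).comp (tendsto_const_one_div x)
      · simp [indicator_of_notMem hv]
  · filter_upwards [hG] with v hv
    rw [indicator_of_mem hv]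

lemma norm_le_of_tendsto_diffQuot {f : X → ℝ} (hδ : 0 < δ) (hC : 0 ≤ C)
    (hf : ∀ y ∈ Metric.ball x δ, ∀ y' ∈ Metric.ball x δ, |f y - f y'| ≤ C * ‖y - y'‖)
    {p : StrongDual ℝ X}
    (hp : ∀ h, Tendsto (diffQuot f h) (𝓝 x ×ˢ 𝓝[>] (0 : ℝ)) (𝓝 (p h))) : ‖p‖ ≤ C :=
  p.opNorm_le_bound hC fun h => le_of_tendsto (hp h).norm (eventually_abs_diffQuot_le hδ hf h)

/-- Strict differentiation under the integral sign for uniformly Lipschitzian integrands whose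
Clarke subdifferentials are almost everywhere singletons. -/
theorem hasStrictDerivative_integral [CompleteSpace X] [TopologicalSpace.SeparableSpace X]
    [TopologicalSpace.SeparableSpace (StrongDual ℝ X)] [IsFiniteMeasure μ]
    (hδ : 0 < δ) (hC : 0 ≤ C) (hmeas : ∀ y, Measurable (e y)) (hint : ∀ y, Integrable (e y) μ)
    (hlip : ∀ v, ∀ y ∈ Metric.ball x δ, ∀ y' ∈ Metric.ball x δ,
      |e y v - e y' v| ≤ C * ‖y - y'‖)
    (h1 : ∀ᵐ v ∂μ, (clarkeSubdiff (fun y => e y v) x).encard = 1) :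
    Integrable (fun v => strictGradient (fun y => e y v) x) μ ∧
      HasStrictDerivative (fun y => ∫ v, e y v ∂μ)
        (∫ v, strictGradient (fun y => e y v) x ∂μ) x := by
  have hs := ae_hasStrictDerivative hδ hlip h1
  have hI : Integrable (fun v => strictGradient (fun y => e y v) x) μ := by
    refine Integrable.of_bound (aestronglyMeasurable_strictGradient hmeas hs) C ?_
    filter_upwards [hs] with v hv
    exact norm_le_of_tendsto_diffQuot hδ hC (hlip v) hv.tendsto
  refine ⟨hI, hasStrictDerivative_of_tendsto (C := C * μ.real univ) hδ ?_ fun h => ?_⟩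
  · intro y hy y' hy'
    rw [← integral_sub (hint y) (hint y'), ← Real.norm_eq_abs]
    calc _ ≤ (C * ‖y - y'‖) * μ.real univ :=
        norm_integral_le_of_norm_le_const (.of_forall fun v => hlip v y hy y' hy')
      _ = _ := by ring
  · rw [ContinuousLinearMap.integral_apply hI]
    have e1 : diffQuot (fun y => ∫ v, e y v ∂μ) h =
        fun q => ∫ v, diffQuot (fun y => e y v) h q ∂μ := by
      ext q
      simp only [diffQuot]
      rw [integral_div, integral_sub (hint _) (hint _)]
    rw [e1]
    refine tendsto_integral_filter_of_dominated_convergence (fun _ => C * ‖h‖) ?_ ?_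
      (integrable_const _) ?_
    · exact .of_forall fun q =>
        (((hmeas _).sub (hmeas _)).div_const _).aestronglyMeasurable
    · filter_upwards [eventually_snd_pos x, eventually_shift_mem_ball hδ h] with q hq hb
      exact .of_forall fun v => abs_diffQuot_le (hlip v) hq hb.1 hb.2
    · filter_upwards [hs] with v hv using hv.tendsto h

end IntegralFunctional

/-! ### Polar coordinates and the spheric-radial decomposition -/

section Gaussian

open scoped ENNReal

/-- The normalising constant of the Chi-density. -/
noncomputable def chiConst (m : ℕ) : ℝ :=
  (2 : ℝ) ^ (1 - (m : ℝ) / 2) / Real.Gamma ((m : ℝ) / 2)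

lemma chiConst_pos {m : ℕ} (hm : 1 ≤ m) : 0 < chiConst m := by
  have : (0 : ℝ) < m := by exact_mod_cast hm
  have := Real.Gamma_pos_of_pos (half_pos this)
  unfold chiConst
  positivity

lemma chiDensity_eq (m : ℕ) (t : ℝ) :
    chiDensity m t = chiConst m * (t ^ (m - 1) * Real.exp (-t ^ 2 / 2)) := by
  rw [chiDensity, chiConst, mul_assoc]

lemma chiDensity_nonneg {m : ℕ} (hm : 1 ≤ m) {t : ℝ} (ht : 0 ≤ t) : 0 ≤ chiDensity m t := by
  have := chiConst_pos hm
  rw [chiDensity_eq]; positivity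

lemma chiMeasure_apply (m : ℕ) {A : Set ℝ} (hA : MeasurableSet A) :
    chiMeasure m A = ∫⁻ t in A ∩ Ioi 0, ENNReal.ofReal (chiDensity m t) := by
  rw [chiMeasure, withDensity_apply _ hA, Measure.restrict_restrict hA]
  exact setLIntegral_congr (ae_eq_set_inter (ae_eq_refl A) Ioi_ae_eq_Ici.symm)

lemma integral_pow_mul_exp {m : ℕ} (hm : 1 ≤ m) :
    ∫ t in Ioi (0 : ℝ), t ^ (m - 1) * Real.exp (-t ^ 2 / 2) = (chiConst m)⁻¹ := by
  have hm' : (0 : ℝ) < m := by exact_mod_cast hm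
  have h := integral_rpow_mul_exp_neg_mul_rpow (p := 2) (q := (m : ℝ) - 1) (b := 1 / 2)
    two_pos (by linarith) (by norm_num)
  have e : ∫ t in Ioi (0 : ℝ), t ^ (m - 1) * Real.exp (-t ^ 2 / 2) =
      ∫ x in Ioi (0 : ℝ), x ^ ((m : ℝ) - 1) * Real.exp (-(1 / 2) * x ^ (2 : ℝ)) := by
    refine setIntegral_congr_fun measurableSet_Ioi fun t _ => ?_
    rw [← Nat.cast_pred hm, Real.rpow_natCast, Real.rpow_two]
    congr 2
    ring
  rw [e, h, chiConst, inv_div, sub_add_cancel, one_div, Real.inv_rpow two_pos.le,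
    ← Real.rpow_neg two_pos.le, Real.rpow_sub two_pos, Real.rpow_one, neg_div, neg_neg]
  field_simp

lemma chiMeasure_univ {m : ℕ} (hm : 1 ≤ m) : chiMeasure m univ = 1 := by
  have hc := chiConst_pos hm
  have hI : IntegrableOn (fun t : ℝ => t ^ (m - 1) * Real.exp (-t ^ 2 / 2)) (Ioi 0) := by
    -- Without integrability the integral would take the default value `0`, whereas it equals
    -- `(chiConst m)⁻¹ > 0`.
    by_contra hn
    have := integral_pow_mul_exp hm
    rw [integral_undef hn] at this
    exact (inv_pos.2 hc).ne this
  rw [chiMeasure_apply m .univ, univ_inter, ← ofReal_integral_eq_lintegral_ofReal]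
  · simp_rw [chiDensity_eq]
    rw [integral_const_mul, integral_pow_mul_exp hm, mul_inv_cancel₀ hc.ne', ENNReal.ofReal_one]
  · simp only [funext (chiDensity_eq m)]
    exact hI.const_mul _
  · filter_upwards [ae_restrict_mem measurableSet_Ioi] with t ht
    exact chiDensity_nonneg hm (le_of_lt ht)

lemma isProbabilityMeasure_chiMeasure {m : ℕ} (hm : 1 ≤ m) :
    IsProbabilityMeasure (chiMeasure m) := ⟨chiMeasure_univ hm⟩

/-- Integration in polar coordinates. -/
theorem lintegral_eq_lintegral_toSphere {E : Type*} [NormedAddCommGroup E] [NormedSpace ℝ E]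
    [MeasurableSpace E] [BorelSpace E] [FiniteDimensional ℝ E] [Nontrivial E] (μ : Measure E)
    [μ.IsAddHaarMeasure] {f : E → ℝ≥0∞} (hf : Measurable f) :
    ∫⁻ z, f z ∂μ = ∫⁻ v, (∫⁻ r in Ioi (0 : ℝ),
      ENNReal.ofReal (r ^ (Module.finrank ℝ E - 1)) * f (r • (v : E))) ∂μ.toSphere := by
  have hmp := μ.measurePreserving_homeomorphUnitSphereProd
  set F : Metric.sphere (0 : E) 1 × Ioi (0 : ℝ) → ℝ≥0∞ := fun q => f (q.2.1 • (q.1 : E))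
  have hF : Measurable F := by
    refine hf.comp ?_
    exact (measurable_subtype_coe.comp measurable_snd).smul
      (measurable_subtype_coe.comp measurable_fst)
  calc ∫⁻ z, f z ∂μ = ∫⁻ z in ({0}ᶜ : Set E), f z ∂μ := by rw [restrict_compl_singleton]
    _ = ∫⁻ z : ({0}ᶜ : Set E), f z ∂(μ.comap (↑)) :=
      (lintegral_subtype_comap (measurableSet_singleton _).compl _).symm
    _ = ∫⁻ z : ({0}ᶜ : Set E), F (homeomorphUnitSphereProd E z) ∂(μ.comap (↑)) := by
      refine lintegral_congr fun z => ?_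
      have hz : ‖(z : E)‖ ≠ 0 := norm_ne_zero_iff.2 z.2
      simp [F, smul_smul, hz]
    _ = ∫⁻ q, F q ∂(μ.toSphere.prod (.volumeIoiPow (Module.finrank ℝ E - 1))) :=
      hmp.lintegral_comp hF
    _ = ∫⁻ v, ∫⁻ r, F (v, r) ∂(.volumeIoiPow (Module.finrank ℝ E - 1)) ∂μ.toSphere :=
      lintegral_prod _ hF.aemeasurable
    _ = _ := by
      refine lintegral_congr fun v => ?_
      rw [Measure.volumeIoiPow, lintegral_withDensity_eq_lintegral_mul _ (by fun_prop)
        (g := fun r => F (v, r)) (hF.comp measurable_prodMk_left)]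
      exact lintegral_subtype_comap measurableSet_Ioi
        (fun r : ℝ => ENNReal.ofReal (r ^ (Module.finrank ℝ E - 1)) * f (r • (v : E)))

variable {m : ℕ}

/-- The unnormalised standard Gaussian measure. -/
noncomputable def gaussWeight (m : ℕ) : Measure (EuclideanSpace ℝ (Fin m)) :=
  volume.withDensity fun z => ENNReal.ofReal (Real.exp (-‖z‖ ^ 2 / 2))

/-- Polar coordinates for the unnormalised standard Gaussian measure. -/
lemma chiConst_mul_gaussWeight_apply (hm : 1 ≤ m) {A : Set (EuclideanSpace ℝ (Fin m))}
    (hA : MeasurableSet A) :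
    ENNReal.ofReal (chiConst m) * gaussWeight m A =
      ∫⁻ v, chiMeasure m {r | 0 ≤ r ∧ r • (v : EuclideanSpace ℝ (Fin m)) ∈ A}
        ∂(volume : Measure (EuclideanSpace ℝ (Fin m))).toSphere := by
  have : Nonempty (Fin m) := ⟨⟨0, hm⟩⟩
  have hw : Measurable fun z : EuclideanSpace ℝ (Fin m) =>
    ENNReal.ofReal (Real.exp (-‖z‖ ^ 2 / 2)) := by fun_prop
  rw [gaussWeight, withDensity_apply _ hA, ← lintegral_indicator hA,
    lintegral_eq_lintegral_toSphere _ (hw.indicator hA), ← lintegral_const_mul']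
  · refine lintegral_congr fun v => ?_
    have hS : MeasurableSet {r : ℝ | 0 ≤ r ∧ r • (v : EuclideanSpace ℝ (Fin m)) ∈ A} :=
      measurableSet_Ici.inter ((measurable_id.smul_const _) hA)
    rw [chiMeasure_apply m hS, ← Measure.restrict_restrict hS, ← lintegral_indicator hS,
      ← lintegral_const_mul' _ _ ENNReal.ofReal_ne_top]
    refine setLIntegral_congr_fun measurableSet_Ioi fun r hr => ?_
    have hr0 : (0 : ℝ) ≤ r := le_of_lt hr
    have hn : ‖r • (v : EuclideanSpace ℝ (Fin m))‖ = r := by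
      simp [norm_smul, abs_of_nonneg hr0]
    have hc := (chiConst_pos hm).le
    by_cases hrA : r • (v : EuclideanSpace ℝ (Fin m)) ∈ A
    · rw [indicator_of_mem hrA, indicator_of_mem (show r ∈ {r : ℝ | 0 ≤ r ∧
        r • (v : EuclideanSpace ℝ (Fin m)) ∈ A} from ⟨hr0, hrA⟩), hn,
        chiDensity_eq, ENNReal.ofReal_mul hc, ENNReal.ofReal_mul (by positivity),
        finrank_euclideanSpace, Fintype.card_fin]
    · rw [indicator_of_notMem hrA, indicator_of_notMem (show r ∉ {r : ℝ | 0 ≤ r ∧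
        r • (v : EuclideanSpace ℝ (Fin m)) ∈ A} from
          fun h => hrA h.2), mul_zero, mul_zero]
  · exact ENNReal.ofReal_ne_top

lemma gaussWeight_univ_ne_top : gaussWeight m univ ≠ ∞ := by
  have h := GaussianFourier.integral_rexp_neg_mul_sq_norm (V := EuclideanSpace ℝ (Fin m))
    (b := 1 / 2) (by norm_num)
  have hI : Integrable fun z : EuclideanSpace ℝ (Fin m) => Real.exp (-(1 / 2) * ‖z‖ ^ 2) := by
    by_contra hn
    rw [integral_undef hn] at h
    have : 0 < (Real.pi / (1 / 2)) ^
        ((Module.finrank ℝ (EuclideanSpace ℝ (Fin m)) : ℝ) / 2) := by positivity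
    exact this.ne h
  rw [gaussWeight, withDensity_apply _ .univ, Measure.restrict_univ]
  convert! hI.lintegral_lt_top.ne using 5
  ring

instance : IsFiniteMeasure (gaussWeight m) := ⟨gaussWeight_univ_ne_top.lt_top⟩

lemma gaussWeight_univ_ne_zero : gaussWeight m univ ≠ 0 := by
  rw [gaussWeight, withDensity_apply _ .univ, Measure.restrict_univ]
  refine (lintegral_pos_iff_support (by fun_prop)).2 ?_ |>.ne'
  have : Function.support (fun z : EuclideanSpace ℝ (Fin m) =>
      ENNReal.ofReal (Real.exp (-‖z‖ ^ 2 / 2))) = univ := by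
    ext z; simp [Real.exp_pos]
  rw [this]
  exact isOpen_univ.measure_pos _ univ_nonempty

/-- Keeping the total mass as the value at `0` lets `stdGaussian_eq` normalise without evaluating
it. -/
lemma charFun_gaussWeight (t : EuclideanSpace ℝ (Fin m)) :
    charFun (gaussWeight m) t = charFun (gaussWeight m) 0 * Complex.exp (-‖t‖ ^ 2 / 2) := by
  have key : ∀ t, charFun (gaussWeight m) t =
      (Real.pi / (1 / 2 : ℂ)) ^ (Module.finrank ℝ (EuclideanSpace ℝ (Fin m)) / 2 : ℂ) *
        Complex.exp (-‖t‖ ^ 2 / 2) := by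
    intro t
    have h := GaussianFourier.integral_cexp_neg_mul_sq_norm_add (b := (1 / 2 : ℂ)) (by norm_num)
      Complex.I t
    rw [charFun_apply, gaussWeight, integral_withDensity_eq_integral_toReal_smul (by fun_prop)
      (.of_forall fun _ => ENNReal.ofReal_lt_top)]
    convert! h using 2
    · ext z
      rw [ENNReal.toReal_ofReal (Real.exp_pos _).le, Complex.real_smul, Complex.ofReal_exp,
        ← Complex.exp_add, real_inner_comm]
      congr 1
      push_cast
      ring
    · rw [Complex.I_sq]
      congr 1
      ring
  rw [key t, key 0]
  simp

/-- The standard Gaussian measure has density proportional to `exp (-‖z‖² / 2)`. -/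
lemma stdGaussian_eq : stdGaussian (EuclideanSpace ℝ (Fin m)) =
    (gaussWeight m univ)⁻¹ • gaussWeight m := by
  have : IsFiniteMeasure ((gaussWeight m univ)⁻¹ • gaussWeight m) :=
    Measure.smul_finite _ (ENNReal.inv_ne_top.2 gaussWeight_univ_ne_zero)
  apply Measure.ext_of_charFun
  ext t
  have h0 : (gaussWeight m).real univ ≠ 0 :=
    (ENNReal.toReal_pos gaussWeight_univ_ne_zero gaussWeight_univ_ne_top).ne'
  rw [charFun_stdGaussian, charFun_apply, integral_smul_measure, ← charFun_apply,
    charFun_gaussWeight, charFun_zero, ENNReal.toReal_inv, Complex.real_smul, ← mul_assoc,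
    ← Measure.real, ← Complex.ofReal_mul, inv_mul_cancel₀ h0, Complex.ofReal_one, one_mul]

lemma isProbabilityMeasure_sphereUniform (hm : 1 ≤ m) :
    IsProbabilityMeasure (sphereUniform m) := by
  have : Nonempty (Fin m) := ⟨⟨0, hm⟩⟩
  refine ⟨?_⟩
  rw [sphereUniform, Measure.smul_apply, smul_eq_mul]
  exact ENNReal.inv_mul_cancel (Measure.measure_univ_ne_zero.2
    (Measure.toSphere_ne_zero (E := EuclideanSpace ℝ (Fin m)) _)) (measure_ne_top _ _)

/-- The spheric-radial decomposition of the standard Gaussian measure. -/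
theorem stdGaussian_apply (hm : 1 ≤ m) {A : Set (EuclideanSpace ℝ (Fin m))}
    (hA : MeasurableSet A) :
    stdGaussian (EuclideanSpace ℝ (Fin m)) A =
      ∫⁻ v, chiMeasure m {r | 0 ≤ r ∧ r • (v : EuclideanSpace ℝ (Fin m)) ∈ A}
        ∂(sphereUniform m) := by
  have hk0 : ENNReal.ofReal (chiConst m) ≠ 0 := by simpa using chiConst_pos hm
  -- Taking the whole space shows that `chiConst m` times the Gaussian mass is the surface area of
  -- the sphere, so all normalising constants cancel.
  have h1 := chiConst_mul_gaussWeight_apply hm MeasurableSet.univ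
  have h2 : chiMeasure m {r | 0 ≤ r} = 1 := by
    change chiMeasure m (Ici 0) = 1
    rw [chiMeasure_apply m measurableSet_Ici, inter_eq_self_of_subset_right Ioi_subset_Ici_self,
      ← chiMeasure_univ hm, chiMeasure_apply m .univ, univ_inter]
  simp only [mem_univ, and_true, h2, lintegral_const, one_mul] at h1
  rw [sphereUniform, lintegral_smul_measure, ← chiConst_mul_gaussWeight_apply hm hA, ← h1,
    stdGaussian_eq, Measure.smul_apply, smul_eq_mul, smul_eq_mul,
    ENNReal.mul_inv (.inl hk0) (.inl ENNReal.ofReal_ne_top), mul_mul_mul_comm,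
    ENNReal.inv_mul_cancel hk0 ENNReal.ofReal_ne_top, one_mul]

/-- A linear image of a standard Gaussian vector is Gaussian. -/
lemma multivariateGaussian_eq_map {R L : Matrix (Fin m) (Fin m) ℝ} (hR : R.PosSemidef)
    (hRL : R = L * L.transpose) : multivariateGaussian 0 R =
      (stdGaussian (EuclideanSpace ℝ (Fin m))).map (Matrix.toEuclideanCLM (𝕜 := ℝ) L) := by
  apply IsGaussian.ext
  · simp only [id_eq]
    rw [ContinuousLinearMap.integral_id_map IsGaussian.integrable_id]
    simp
  · ext x y
    rw [covarianceBilin_multivariateGaussian hR, covarianceBilin_map IsGaussian.memLp_two_id,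
      covarianceBilin_stdGaussian, innerSL_apply_apply, ContinuousLinearMap.adjoint_inner_left,
      ← ContinuousLinearMap.star_eq_adjoint, ← map_star, ← mul_apply_eq_comp,
      ← map_mul, Matrix.inner_toEuclideanCLM, hRL, Matrix.star_eq_conjTranspose,
      Matrix.conjTranspose_eq_transpose_of_trivial]

end Gaussian

/-! ### Chi-density estimates and the comparison on one ray -/

section RadialEstimate

variable {m : ℕ}

lemma chiMeasure_real_le_of_subset_Ioc {A : Set ℝ} (hA : MeasurableSet A)
    {r τ D : ℝ} (hτ : 0 ≤ τ) (hD : 0 ≤ D) (hsub : A ⊆ Ioc r (r + τ))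
    (hle : ∀ t ∈ A, 0 < t → chiDensity m t ≤ D) : (chiMeasure m).real A ≤ D * τ := by
  refine ENNReal.toReal_le_of_le_ofReal (by positivity) ?_
  rw [chiMeasure_apply m hA]
  calc ∫⁻ t in A ∩ Ioi 0, ENNReal.ofReal (chiDensity m t)
      ≤ ∫⁻ t in A ∩ Ioi 0, ENNReal.ofReal D :=
        setLIntegral_mono measurable_const fun t ht => ENNReal.ofReal_le_ofReal (hle t ht.1 ht.2)
    _ = ENNReal.ofReal D * volume (A ∩ Ioi 0) := setLIntegral_const _ _
    _ ≤ ENNReal.ofReal D * volume (Ioc r (r + τ)) := by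
        gcongr; exact inter_subset_left.trans hsub
    _ = ENNReal.ofReal (D * τ) := by
        rw [Real.volume_Ioc, add_sub_cancel_left, ENNReal.ofReal_mul hD]

/-- Exponential decay of the Chi-density beyond a large radius. -/
lemma chiDensity_le_mul_exp (hm : 1 ≤ m) {r t : ℝ} (hr : 2 * (m : ℝ) ≤ r) (hrt : r ≤ t) :
    chiDensity m t ≤ chiDensity m r * Real.exp (-(r / 2) * (t - r)) := by
  have hm' : (1 : ℝ) ≤ m := by exact_mod_cast hm
  have hr0 : 0 < r := by linarith
  have hc := chiConst_pos hm
  rw [chiDensity_eq, chiDensity_eq, mul_assoc]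
  refine mul_le_mul_of_nonneg_left ?_ hc.le
  have h1 : t ^ (m - 1) ≤ r ^ (m - 1) * Real.exp (((m : ℝ) - 1) * ((t - r) / r)) := by
    rw [← Nat.cast_pred hm, Real.exp_nat_mul, ← mul_pow]
    gcongr
    · linarith
    calc t = r * ((t - r) / r + 1) := by field_simp; ring
      _ ≤ r * Real.exp ((t - r) / r) := by gcongr; exact Real.add_one_le_exp _
  -- The Gaussian factor decays at least like `exp(-r (t - r))`; as `r ≥ 2m`, the polynomial factor
  -- consumes at most half of this rate.
  have h2 : ((m : ℝ) - 1) * ((t - r) / r) ≤ (r / 2) * (t - r) := by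
    rw [← mul_div_assoc, div_le_iff₀ hr0]
    have : (m : ℝ) - 1 ≤ r / 2 * r := by nlinarith
    nlinarith [mul_le_mul_of_nonneg_right this (sub_nonneg.2 hrt)]
  calc t ^ (m - 1) * Real.exp (-t ^ 2 / 2)
      ≤ r ^ (m - 1) * Real.exp (((m : ℝ) - 1) * ((t - r) / r)) * Real.exp (-t ^ 2 / 2) := by
        gcongr
    _ = r ^ (m - 1) * Real.exp (((m : ℝ) - 1) * ((t - r) / r) + -t ^ 2 / 2) := by
        rw [mul_assoc, Real.exp_add]
    _ ≤ r ^ (m - 1) * Real.exp (-r ^ 2 / 2 + -(r / 2) * (t - r)) := by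
        refine mul_le_mul_of_nonneg_left (Real.exp_le_exp.2 ?_) (by positivity)
        nlinarith [sq_nonneg (t - r)]
    _ = _ := by rw [Real.exp_add, mul_assoc]

lemma chiDensity_le_chiDensity (hm : 1 ≤ m) {r t : ℝ} (hr : 2 * (m : ℝ) ≤ r) (hrt : r ≤ t) :
    chiDensity m t ≤ chiDensity m r := by
  have hm' : (1 : ℝ) ≤ m := by exact_mod_cast hm
  refine (chiDensity_le_mul_exp hm hr hrt).trans
    (mul_le_of_le_one_right (chiDensity_nonneg hm (by linarith)) ?_)
  rw [Real.exp_le_one_iff]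
  nlinarith

/-- Tail estimate for the Chi-distribution. -/
lemma chiMeasure_real_Ioi_le (hm : 1 ≤ m) {r : ℝ} (hr : 2 * (m : ℝ) ≤ r) :
    (chiMeasure m).real (Ioi r) ≤ chiDensity m r * (2 / r) := by
  have hm' : (1 : ℝ) ≤ m := by exact_mod_cast hm
  have hr0 : 0 < r := by linarith
  have hχ := chiDensity_nonneg hm hr0.le
  refine ENNReal.toReal_le_of_le_ofReal (by positivity) ?_
  rw [chiMeasure_apply m measurableSet_Ioi, inter_eq_self_of_subset_left (Ioi_subset_Ioi hr0.le)]
  have ha : -(r / 2) < 0 := by linarith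
  have e : ∀ t, Real.exp (-(r / 2) * (t - r)) =
      Real.exp (-(r / 2) * t) * Real.exp (r / 2 * r) := fun t => by
    rw [← Real.exp_add]; ring_nf
  have hI : IntegrableOn (fun t => chiDensity m r * Real.exp (-(r / 2) * (t - r))) (Ioi r) := by
    simp_rw [e]
    exact ((integrableOn_exp_mul_Ioi ha r).mul_const _).const_mul _
  calc ∫⁻ t in Ioi r, ENNReal.ofReal (chiDensity m t)
      ≤ ∫⁻ t in Ioi r, ENNReal.ofReal (chiDensity m r * Real.exp (-(r / 2) * (t - r))) :=
        setLIntegral_mono (by fun_prop) fun t ht =>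
          ENNReal.ofReal_le_ofReal (chiDensity_le_mul_exp hm hr (le_of_lt ht))
    _ = ENNReal.ofReal (∫ t in Ioi r, chiDensity m r * Real.exp (-(r / 2) * (t - r))) :=
        (ofReal_integral_eq_lintegral_ofReal hI (.of_forall fun t => by positivity)).symm
    _ = _ := by
        congr 1
        simp_rw [e]
        rw [integral_const_mul, integral_mul_const, integral_exp_mul_Ioi ha, neg_div, div_neg,
          neg_neg, div_mul_eq_mul_div, ← Real.exp_add]
        simp

lemma exists_chiDensity_le (m : ℕ) (N : ℝ) :
    ∃ D, 0 ≤ D ∧ ∀ t ∈ Icc 0 N, chiDensity m t ≤ D := by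
  have hc : Continuous (chiDensity m) := by unfold chiDensity; fun_prop
  obtain ⟨D, hD⟩ := (isCompact_Icc (a := (0 : ℝ)) (b := N)).bddAbove_image hc.continuousOn
  exact ⟨|D|, abs_nonneg D, fun t ht => (hD ⟨t, ht, rfl⟩).trans (le_abs_self D)⟩

/-- Comparability of the Chi-density on `[r, r + 1 / r]`. -/
lemma chiDensity_le_exp_two_mul (hm : 1 ≤ m) {r s : ℝ} (hr : 1 ≤ r) (hrs : r ≤ s)
    (hs : s ≤ r + 1 / r) : chiDensity m r ≤ Real.exp 2 * chiDensity m s := by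
  have hc := chiConst_pos hm
  have hr0 : 0 < r := by linarith
  have hs0 : 0 < s := by linarith
  have h1 : s ^ 2 ≤ r ^ 2 + 4 := by
    have h2 : 1 / r ≤ 1 := (div_le_one hr0).2 hr
    have h3 : (r + 1 / r) ^ 2 = r ^ 2 + 2 + (1 / r) ^ 2 := by field_simp; ring
    have h4 : s ^ 2 ≤ (r + 1 / r) ^ 2 := by gcongr
    have h5 : (1 / r) ^ 2 ≤ 1 := pow_le_one₀ (by positivity) h2
    linarith
  rw [chiDensity_eq, chiDensity_eq]
  calc chiConst m * (r ^ (m - 1) * Real.exp (-r ^ 2 / 2))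
      ≤ chiConst m * (s ^ (m - 1) * Real.exp (2 + -s ^ 2 / 2)) := by
        gcongr
        · linarith
    _ = _ := by rw [Real.exp_add]; ring

/-- One-sided comparison of the Chi-measures of two sublevel sets of convex functions on a ray. -/
theorem chiMeasure_real_sub_le (hm : 1 ≤ m) {a b : ℝ → ℝ} (ha : ConvexOn ℝ univ a)
    (hb : ConvexOn ℝ univ b) (hac : Continuous a) (hbc : Continuous b) {c d N K M D : ℝ}
    (hc : 0 < c) (hd : 0 ≤ d) (hN : 2 * (m : ℝ) ≤ N) (hK : 0 ≤ K) (hM : 0 ≤ M) (hD : 0 ≤ D)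
    (ha0 : a 0 ≤ -c) (hb0 : b 0 ≤ -c)
    (hab : ∀ s ∈ Icc 0 (N + 1), b s - a s ≤ K * d) (hdN : N * (K * d) ≤ c / 2)
    (hχ : ∀ t ∈ Icc 0 (N + 1), chiDensity m t ≤ D)
    (hfar : 0 < b N ∨ ∀ s, N ≤ s → b s - a s ≤ M * (s ^ m)⁻¹ * Real.exp (s ^ 2 / 2) * d) :
    (chiMeasure m).real {r | 0 ≤ r ∧ a r ≤ 0} - (chiMeasure m).real {r | 0 ≤ r ∧ b r ≤ 0} ≤
      (D * (N * K / c) + 2 * (chiConst m * Real.exp 2 * (M / c))) * d := by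
  have hprob := isProbabilityMeasure_chiMeasure hm
  have hm' : (1 : ℝ) ≤ m := by exact_mod_cast hm
  have hk := chiConst_pos hm
  have hN0 : 0 < N := by linarith
  set Sa := {r | 0 ≤ r ∧ a r ≤ 0} with hSa
  set Sb := {r | 0 ≤ r ∧ b r ≤ 0} with hSb
  have hSam : MeasurableSet Sa :=
    measurableSet_Ici.inter (measurableSet_le hac.measurable measurable_const)
  have hfirst : 0 ≤ D * (N * K / c) * d := by positivity
  have hsecond : 0 ≤ chiConst m * Real.exp 2 * (M / c) * d := by positivity
  by_cases hsub : Sa ⊆ Sb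
  · have : (chiMeasure m).real Sa ≤ (chiMeasure m).real Sb := measureReal_mono hsub
    nlinarith
  obtain ⟨s₀, hs₀, hs₀b⟩ := not_subset.1 hsub
  have hbs₀ : 0 < b s₀ := by
    by_contra h
    exact hs₀b ⟨hs₀.1, not_lt.1 h⟩
  -- `r` is the exit radius for `b`; only the overshoot of `Sa` beyond `r` can contribute to the
  -- difference.
  obtain ⟨r, hr, hbr⟩ : (0 : ℝ) ∈ b '' Icc 0 s₀ :=
    intermediate_value_Icc hs₀.1 hbc.continuousOn ⟨by linarith, hbs₀.le⟩
  have hr0 : 0 < r := hr.1.lt_of_ne fun h => by rw [← h] at hbr; linarith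
  -- Convexity on `[0, s]` with `b 0 ≤ -c` and `b r = 0`: past `r`, `b` grows at rate at least `c /
  -- r`.
  have hslope : ∀ s, r < s → c * (s - r) ≤ r * b s := by
    intro s hs
    have hs0 : 0 < s := hr0.trans hs
    have := hb.2 (mem_univ 0) (mem_univ s) (sub_nonneg.2 ((div_le_one hs0).2 hs.le))
      (by positivity : 0 ≤ r / s) (by ring)
    simp only [smul_eq_mul, mul_zero, zero_add, div_mul_cancel₀ _ hs0.ne', hbr] at this
    have h1 : 0 ≤ 1 - r / s := sub_nonneg.2 ((div_le_one hs0).2 hs.le)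
    have h2 : (1 - r / s) * c ≤ r / s * b s := by nlinarith
    have h3 := mul_le_mul_of_nonneg_right h2 hs0.le
    calc c * (s - r) = (1 - r / s) * c * s := by field_simp
      _ ≤ r / s * b s * s := h3
      _ = r * b s := by field_simp
  have hIb : Icc 0 r ⊆ Sb := by
    intro t ht
    refine ⟨ht.1, ?_⟩
    have := hb.le_max_of_mem_Icc (mem_univ 0) (mem_univ r) ht
    exact this.trans (max_le (by linarith) hbr.le)
  have hIa : ∀ s ∈ Sa, ∀ t ∈ Icc 0 s, t ∈ Sa := by
    intro s hs t ht
    refine ⟨ht.1, ?_⟩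
    have := ha.le_max_of_mem_Icc (mem_univ 0) (mem_univ s) ht
    exact this.trans (max_le (by linarith) hs.2)
  have hgap : ∀ s ∈ Sa, r < s → c * (s - r) ≤ r * (b s - a s) := by
    intro s hs hrs
    have := hslope s hrs
    nlinarith [hs.2]
  have hmeas : (chiMeasure m).real Sa - (chiMeasure m).real Sb ≤
      (chiMeasure m).real (Sa ∩ Ioi r) := by
    have h1 : Sa ⊆ Sb ∪ (Sa ∩ Ioi r) := by
      intro t ht
      rcases le_or_gt t r with h | h
      · exact .inl (hIb ⟨ht.1, h⟩)
      · exact .inr ⟨ht, h⟩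
    have := (measureReal_mono (μ := chiMeasure m) h1).trans (measureReal_union_le _ _)
    linarith
  have hTm : MeasurableSet (Sa ∩ Ioi r) := hSam.inter measurableSet_Ioi
  refine hmeas.trans ?_
  rcases le_or_gt r N with hrN | hrN
  · have hshort : Sa ∩ Ioi r ⊆ Ioc r (r + N * K / c * d) := by
      rintro s ⟨hs, hrs⟩
      rw [mem_Ioi] at hrs
      refine ⟨hrs, ?_⟩
      -- The Lipschitz bound reaches only to `N + 1`, so `s` is capped at `r + 1`. The bound then
      -- gives `t - r ≤ 1 / 2`, so the cap is inactive and `t = s`.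
      set t := min s (r + 1) with ht
      have hrt : r < t := lt_min hrs (by linarith)
      have htN : t ≤ N + 1 := (min_le_right _ _).trans (by linarith)
      have hta : t ∈ Sa := hIa s hs t ⟨by linarith, min_le_left _ _⟩
      have h1 := hgap t hta hrt
      have h2 := hab t ⟨by linarith, htN⟩
      have hKd : 0 ≤ K * d := by positivity
      have h3 : c * (t - r) ≤ N * (K * d) :=
        h1.trans ((mul_le_mul_of_nonneg_left h2 hr0.le).trans (by gcongr))
      have h4 : t - r ≤ 1 / 2 := by
        have : c * (t - r) ≤ c * (1 / 2) := by linarith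
        exact le_of_mul_le_mul_left this hc
      have h5 : t = s := by
        rcases min_choice s (r + 1) with h | h
        · exact h
        · rw [← ht] at h; linarith
      rw [← h5]
      have h6 : t - r ≤ N * (K * d) / c := by
        rw [le_div_iff₀ hc]; linarith
      have h7 : N * (K * d) / c = N * K / c * d := by ring
      linarith
    have hτ : N * K / c * d ≤ 1 := by
      have : N * K / c * d = N * (K * d) / c := by ring
      rw [this, div_le_one hc]; linarith
    have := chiMeasure_real_le_of_subset_Ioc hTm (by positivity) hD hshort fun t ht ht0 =>
      hχ t ⟨ht0.le, (hshort ht).2.trans (by linarith)⟩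
    calc _ ≤ _ := this
      _ ≤ _ := by nlinarith
  · rcases hfar with hfar | hfar
    · exact absurd (hIb ⟨hN0.le, hrN.le⟩).2 (not_le.2 hfar)
    have hmr : 2 * (m : ℝ) ≤ r := hN.trans hrN.le
    have hr1 : 1 ≤ r := by linarith
    have hχr := chiDensity_nonneg hm hr0.le
    -- Overshoot times density is `O(d)`: the factor `s · s⁻ᵐ exp(s² / 2)` cancels `s ^ (m - 1)
    -- exp(-s² / 2)` exactly.
    have hkey : ∀ s ∈ Sa, r < s → chiDensity m s * (s - r) ≤ chiConst m * (M / c) * d := by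
      intro s hs hrs
      have hs0 : 0 < s := hr0.trans hrs
      have h1 := hgap s hs hrs
      have h2 := hfar s (hrN.le.trans hrs.le)
      have h3 : c * (s - r) ≤ s * (M * (s ^ m)⁻¹ * Real.exp (s ^ 2 / 2) * d) :=
        h1.trans ((mul_le_mul_of_nonneg_left h2 hr0.le).trans (by gcongr))
      have hpow : s ^ m = s ^ (m - 1) * s := by
        rw [← pow_succ, Nat.sub_add_cancel hm]
      have hexp : Real.exp (-s ^ 2 / 2) * Real.exp (s ^ 2 / 2) = 1 := by
        rw [← Real.exp_add]; ring_nf; simp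
      rw [chiDensity_eq]
      calc chiConst m * (s ^ (m - 1) * Real.exp (-s ^ 2 / 2)) * (s - r)
          = chiConst m * (s ^ (m - 1) * Real.exp (-s ^ 2 / 2)) * (c * (s - r)) / c := by
            field_simp
        _ ≤ chiConst m * (s ^ (m - 1) * Real.exp (-s ^ 2 / 2)) *
              (s * (M * (s ^ m)⁻¹ * Real.exp (s ^ 2 / 2) * d)) / c := by gcongr
        _ = chiConst m * (M / c) * d * (Real.exp (-s ^ 2 / 2) * Real.exp (s ^ 2 / 2)) *
              ((s ^ (m - 1) * s) * (s ^ m)⁻¹) := by ring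
        _ = chiConst m * (M / c) * d := by
            rw [hexp, ← hpow, mul_inv_cancel₀ (pow_pos hs0 m).ne', mul_one, mul_one]
    -- The Chi-density has decay length of order `1 / r`. An overshoot beyond `1 / r` lets `hkey` at
    -- `r + 1 / r` control the whole tail; a shorter one stays where the density is comparable to
    -- its value at `r`.
    by_cases hlong : ∃ s ∈ Sa, r + 1 / r < s
    · obtain ⟨s, hs, hrs⟩ := hlong
      have hr1' : 0 < 1 / r := by positivity
      have hmem := hIa s hs (r + 1 / r) ⟨by positivity, hrs.le⟩
      have h1 := hkey _ hmem (by linarith)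
      rw [add_sub_cancel_left] at h1
      have h2 := chiDensity_le_exp_two_mul hm hr1 (by linarith : r ≤ r + 1 / r) le_rfl
      calc (chiMeasure m).real (Sa ∩ Ioi r) ≤ (chiMeasure m).real (Ioi r) :=
            measureReal_mono inter_subset_right
        _ ≤ chiDensity m r * (2 / r) := chiMeasure_real_Ioi_le hm hmr
        _ ≤ Real.exp 2 * chiDensity m (r + 1 / r) * (2 / r) := by gcongr
        _ = 2 * Real.exp 2 * (chiDensity m (r + 1 / r) * (1 / r)) := by ring
        _ ≤ 2 * Real.exp 2 * (chiConst m * (M / c) * d) := by gcongr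
        _ ≤ _ := by nlinarith
    · push Not at hlong
      rcases hχr.eq_or_lt with h0 | hpos
      · have : (chiMeasure m).real (Sa ∩ Ioi r) ≤ chiDensity m r * (2 / r) :=
          (measureReal_mono inter_subset_right).trans (chiMeasure_real_Ioi_le hm hmr)
        rw [← h0, zero_mul] at this
        nlinarith
      set τ := Real.exp 2 * (chiConst m * (M / c) * d) / chiDensity m r with hτ
      have hτ0 : 0 ≤ τ := by positivity
      have hshort : Sa ∩ Ioi r ⊆ Ioc r (r + τ) := by
        rintro s ⟨hs, hrs⟩
        rw [mem_Ioi] at hrs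
        refine ⟨hrs, ?_⟩
        have h1 := hkey s hs hrs
        have h2 := chiDensity_le_exp_two_mul hm hr1 hrs.le (hlong s hs)
        have h3 : s - r ≤ τ := by
          rw [hτ, le_div_iff₀ hpos]
          calc (s - r) * chiDensity m r
              ≤ (s - r) * (Real.exp 2 * chiDensity m s) :=
                mul_le_mul_of_nonneg_left h2 (sub_nonneg.2 hrs.le)
            _ = Real.exp 2 * (chiDensity m s * (s - r)) := by ring
            _ ≤ _ := by gcongr
        linarith
      have := chiMeasure_real_le_of_subset_Ioc hTm hτ0 hχr hshort fun t ht _ =>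
        chiDensity_le_chiDensity hm hmr (le_of_lt ht.2)
      have e : chiDensity m r * τ = Real.exp 2 * (chiConst m * (M / c) * d) := by
        rw [hτ]; field_simp
      rw [e] at this
      nlinarith

end RadialEstimate

/-! ### Measurability in the direction and the integral formula for the probability -/

section Measurability

variable {m : ℕ} {X : Type*} [PseudoMetricSpace X]
  {g : X → EuclideanSpace ℝ (Fin m) → ℝ} {L : Matrix (Fin m) (Fin m) ℝ}

lemma continuous_ray (hg : LocallyLipschitz fun p : X × EuclideanSpace ℝ (Fin m) => g p.1 p.2)
    (y : X) (w : EuclideanSpace ℝ (Fin m)) : Continuous fun s : ℝ => g y (s • w) :=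
  hg.continuous.comp (by fun_prop : Continuous fun s : ℝ => (y, s • w))

lemma convexOn_ray {Y : Type*} {g : Y → EuclideanSpace ℝ (Fin m) → ℝ}
    (hg : ∀ y, ConvexOn ℝ univ (g y)) (y : Y) (w : EuclideanSpace ℝ (Fin m)) :
    ConvexOn ℝ univ fun s : ℝ => g y (s • w) := by
  have := (hg y).comp_linearMap (LinearMap.toSpanSingleton ℝ _ w)
  simpa [Function.comp_def] using this

lemma measurable_chiMeasure_ray (hm : 1 ≤ m)
    (hgLip : LocallyLipschitz fun p : X × EuclideanSpace ℝ (Fin m) => g p.1 p.2) (y : X) :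
    Measurable fun v : UnitSphere m => chiMeasure m {r | 0 ≤ r ∧
      g y (r • Matrix.toEuclideanCLM (𝕜 := ℝ) L (v : EuclideanSpace ℝ (Fin m))) ≤ 0} := by
  have := isProbabilityMeasure_chiMeasure hm
  have hc : Continuous fun q : UnitSphere m × ℝ =>
      g y (q.2 • Matrix.toEuclideanCLM (𝕜 := ℝ) L (q.1 : EuclideanSpace ℝ (Fin m))) :=
    hgLip.continuous.comp (by fun_prop : Continuous fun q : UnitSphere m × ℝ =>
      (y, q.2 • Matrix.toEuclideanCLM (𝕜 := ℝ) L (q.1 : EuclideanSpace ℝ (Fin m))))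
  have hS : MeasurableSet {q : UnitSphere m × ℝ | 0 ≤ q.2 ∧
      g y (q.2 • Matrix.toEuclideanCLM (𝕜 := ℝ) L (q.1 : EuclideanSpace ℝ (Fin m))) ≤ 0} :=
    ((isClosed_le continuous_const continuous_snd).inter
      (isClosed_le hc continuous_const)).measurableSet
  have h := measurable_measure_prodMk_left (ν := chiMeasure m) hS
  simpa only [preimage_ofPred_eq] using h

lemma measurable_radialProb (hm : 1 ≤ m)
    (hgLip : LocallyLipschitz fun p : X × EuclideanSpace ℝ (Fin m) => g p.1 p.2) (y : X) :
    Measurable (radialProb g L y) :=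
  (measurable_chiMeasure_ray hm hgLip y).ennreal_toReal

lemma integrable_radialProb (hm : 1 ≤ m)
    (hgLip : LocallyLipschitz fun p : X × EuclideanSpace ℝ (Fin m) => g p.1 p.2) (y : X) :
    Integrable (radialProb g L y) (sphereUniform m) := by
  have := isProbabilityMeasure_chiMeasure hm
  have := isProbabilityMeasure_sphereUniform hm
  refine Integrable.of_bound (measurable_radialProb hm hgLip y).aestronglyMeasurable 1
    (.of_forall fun v => ?_)
  rw [radialProb, Real.norm_eq_abs, abs_of_nonneg measureReal_nonneg]
  exact measureReal_le_one

/-- The spheric-radial decomposition of the probability function. -/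
theorem probFun_eq_integral_radialProb (hm : 1 ≤ m)
    (hgLip : LocallyLipschitz fun p : X × EuclideanSpace ℝ (Fin m) => g p.1 p.2)
    {R : Matrix (Fin m) (Fin m) ℝ} (hR : R.PosSemidef) (hRL : R = L * L.transpose)
    {Ω : Type*} [MeasurableSpace Ω] {P : Measure Ω} {ξ : Ω → EuclideanSpace ℝ (Fin m)}
    (hξ : HasLaw ξ (multivariateGaussian 0 R) P) (y : X) :
    probFun P ξ g y = ∫ v, radialProb g L y v ∂(sphereUniform m) := by
  have := isProbabilityMeasure_chiMeasure hm
  set T := Matrix.toEuclideanCLM (𝕜 := ℝ) L with hT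
  have hcont : Continuous (g y) :=
    hgLip.continuous.comp (by fun_prop : Continuous fun z : EuclideanSpace ℝ (Fin m) => (y, z))
  have hA : MeasurableSet {z | g y z ≤ 0} := (isClosed_le hcont continuous_const).measurableSet
  have h1 : P {ω | g y (ξ ω) ≤ 0} = ∫⁻ v, chiMeasure m
      {r | 0 ≤ r ∧ g y (r • T (v : EuclideanSpace ℝ (Fin m))) ≤ 0} ∂(sphereUniform m) := by
    change P (ξ ⁻¹' {z | g y z ≤ 0}) = _
    rw [← Measure.map_apply_of_aemeasurable hξ.aemeasurable hA, hξ.map_eq,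
      multivariateGaussian_eq_map hR hRL, Measure.map_apply T.continuous.measurable hA,
      stdGaussian_apply hm (T.continuous.measurable hA)]
    simp [hT]
  rw [probFun, Measure.real, h1]
  exact (integral_toReal (measurable_chiMeasure_ray hm hgLip y).aemeasurable
    (.of_forall fun v => measure_lt_top _ _)).symm

end Measurability

/-! ### Lipschitz bound uniform in the direction -/

section RadialProb

variable {m : ℕ}

/-- `L` is invertible because `det R = (det L)² > 0`. The bound `κ` turns large radii into large `‖r
L v‖` uniformly in `v`. -/
lemma exists_le_norm_toEuclideanCLM {R L : Matrix (Fin m) (Fin m) ℝ} (hR : R.PosDef)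
    (hRL : R = L * L.transpose) :
    ∃ κ : ℝ, 0 < κ ∧ ∀ v : UnitSphere m,
      κ ≤ ‖Matrix.toEuclideanCLM (𝕜 := ℝ) L (v : EuclideanSpace ℝ (Fin m))‖ := by
  have hdet : IsUnit L.det := by
    have := hR.det_pos
    rw [hRL, Matrix.det_mul, Matrix.det_transpose] at this
    exact isUnit_iff_ne_zero.2 fun h => by simp [h] at this
  set S := Matrix.toEuclideanCLM (𝕜 := ℝ) L⁻¹
  refine ⟨(‖S‖ + 1)⁻¹, by positivity, fun v => ?_⟩
  have h1 : S (Matrix.toEuclideanCLM (𝕜 := ℝ) L (v : EuclideanSpace ℝ (Fin m))) = v := by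
    rw [← mul_apply_eq_comp, ← map_mul, Matrix.nonsing_inv_mul _ hdet, map_one]
    rfl
  have h2 := S.le_opNorm (Matrix.toEuclideanCLM (𝕜 := ℝ) L (v : EuclideanSpace ℝ (Fin m)))
  rw [h1, norm_eq_of_mem_sphere] at h2
  rw [inv_le_iff_one_le_mul₀ (by positivity)]
  nlinarith [norm_nonneg (Matrix.toEuclideanCLM (𝕜 := ℝ) L (v : EuclideanSpace ℝ (Fin m)))]

variable {X : Type*} [NormedAddCommGroup X] [NormedSpace ℝ X]
  {g : X → EuclideanSpace ℝ (Fin m) → ℝ} {L : Matrix (Fin m) (Fin m) ℝ} {x : X}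

/-- A locally Lipschitzian function of two variables is Lipschitzian in the first one, uniformly
for the second one in a compact set. -/
lemma exists_lipschitz_of_isCompact {Y Z : Type*} [SeminormedAddCommGroup Y]
    [PseudoMetricSpace Z] {f : Y → Z → ℝ}
    (hf : LocallyLipschitz fun p : Y × Z => f p.1 p.2) (x : Y) {S : Set Z} (hS : IsCompact S) :
    ∃ δ > 0, ∃ K, 0 ≤ K ∧ ∀ z ∈ S, ∀ y ∈ Metric.ball x δ, ∀ y' ∈ Metric.ball x δ,
      |f y z - f y' z| ≤ K * ‖y - y'‖ := by
  refine hS.induction_on (p := fun S => ∃ δ > 0, ∃ K, 0 ≤ K ∧ ∀ z ∈ S, ∀ y ∈ Metric.ball x δ,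
    ∀ y' ∈ Metric.ball x δ, |f y z - f y' z| ≤ K * ‖y - y'‖) ⟨1, one_pos, 0, le_rfl, by simp⟩
    ?_ ?_ ?_
  · rintro s t hst ⟨δ, hδ, K, hK, h⟩
    exact ⟨δ, hδ, K, hK, fun z hz => h z (hst hz)⟩
  · rintro s t ⟨δ, hδ, K, hK, h⟩ ⟨δ', hδ', K', hK', h'⟩
    have hb := Metric.ball_subset_ball (x := x) (min_le_left δ δ')
    have hb' := Metric.ball_subset_ball (x := x) (min_le_right δ δ')
    refine ⟨min δ δ', lt_min hδ hδ', max K K', hK.trans (le_max_left _ _), ?_⟩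
    rintro z (hz | hz) y hy y' hy'
    · exact (h z hz y (hb hy) y' (hb hy')).trans (by gcongr; exact le_max_left _ _)
    · exact (h' z hz y (hb' hy) y' (hb' hy')).trans (by gcongr; exact le_max_right _ _)
  · intro z _
    obtain ⟨K, U, hU, hK⟩ := hf (x, z)
    obtain ⟨A, hA, W, hW, hAW⟩ := mem_nhds_prod_iff.1 hU
    obtain ⟨δ, hδ, hδA⟩ := Metric.mem_nhds_iff.1 hA
    refine ⟨W, mem_nhdsWithin_of_mem_nhds hW, δ, hδ, K, K.2, fun w hw y hy y' hy' => ?_⟩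
    have := hK.dist_le_mul (y, w) (hAW ⟨hδA hy, hw⟩) (y', w) (hAW ⟨hδA hy', hw⟩)
    simpa [Real.dist_eq, Prod.dist_eq, dist_eq_norm] using this

/-- On directions far from the origin, the growth condition bounds increments of `g` along rays
by the reciprocal of the Chi-density. -/
lemma sub_le_of_niceCone_eq_univ {l κ s : ℝ}
    (hg : LocallyLipschitz fun p : X × EuclideanSpace ℝ (Fin m) => g p.1 p.2)
    (hl : 0 < l) (hnice : niceCone g L l x = univ) {v : UnitSphere m} (hκ : 0 < κ)
    (hv : κ ≤ ‖Matrix.toEuclideanCLM (𝕜 := ℝ) L (v : EuclideanSpace ℝ (Fin m))‖)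
    (hs : l / κ ≤ s) {y y' : X} (hy : y ∈ Metric.closedBall x (1 / l))
    (hy' : y' ∈ Metric.closedBall x (1 / l)) :
    g y' (s • Matrix.toEuclideanCLM (𝕜 := ℝ) L (v : EuclideanSpace ℝ (Fin m))) -
      g y (s • Matrix.toEuclideanCLM (𝕜 := ℝ) L (v : EuclideanSpace ℝ (Fin m))) ≤
      l * (κ ^ m)⁻¹ * (s ^ m)⁻¹ * Real.exp (s ^ 2 / 2) * ‖y' - y‖ := by
  set T := Matrix.toEuclideanCLM (𝕜 := ℝ) L
  set z := s • T (v : EuclideanSpace ℝ (Fin m)) with hz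
  have hs0 : 0 < s := (div_pos hl hκ).trans_le hs
  have hnorm : ‖z‖ = s * ‖T v‖ := by rw [hz, norm_smul, Real.norm_eq_abs, abs_of_pos hs0]
  have hlow : s * κ ≤ ‖z‖ := by rw [hnorm]; gcongr
  have hlz : l ≤ ‖z‖ := ((div_le_iff₀ hκ).1 hs).trans hlow
  have hTv : ‖T v‖ ≤ ‖T‖ := by
    have := T.le_opNorm (v : EuclideanSpace ℝ (Fin m))
    rwa [norm_eq_of_mem_sphere, mul_one] at this
  have hT : 0 < ‖T‖ := hκ.trans_le (hv.trans hTv)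
  have hcont : Continuous fun w => g w z :=
    hg.continuous.comp (by fun_prop : Continuous fun w : X => (w, z))
  have h1 := sub_le_of_clarkeDeriv_le (convex_closedBall x (1 / l)) hcont
    (M := l * (‖z‖ ^ m)⁻¹ * Real.exp (‖z‖ ^ 2 / (2 * ‖T‖ ^ 2)))
    (fun w hw h => (hnice ▸ mem_univ h : h ∈ niceCone g L l x) w hw z hlz) hy hy'
  refine h1.trans (mul_le_mul_of_nonneg_right ?_ (norm_nonneg _))
  -- The two-sided bound `κ s ≤ ‖z‖ ≤ ‖L‖ s` rewrites the growth rate in terms of the radius `s`,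
  -- with exponent at most `s² / 2`.
  have h2 : (‖z‖ ^ m)⁻¹ ≤ (κ ^ m)⁻¹ * (s ^ m)⁻¹ := by
    rw [← mul_inv, ← mul_pow, mul_comm κ s]
    have : 0 < s * κ := by positivity
    gcongr
  have h3 : ‖z‖ ^ 2 / (2 * ‖T‖ ^ 2) ≤ s ^ 2 / 2 := by
    rw [hnorm, div_le_div_iff₀ (by positivity) two_pos]
    have : ‖T v‖ ^ 2 ≤ ‖T‖ ^ 2 := by gcongr
    nlinarith [mul_le_mul_of_nonneg_left this (sq_nonneg s)]
  have h4 : l * (‖z‖ ^ m)⁻¹ ≤ l * (κ ^ m)⁻¹ * (s ^ m)⁻¹ := by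
    rw [mul_assoc]
    exact mul_le_mul_of_nonneg_left h2 hl.le
  exact mul_le_mul h4 (Real.exp_le_exp.2 h3)
    (Real.exp_pos _).le (by positivity)

/-- Near a point where the mean is feasible, under boundedness or the growth condition, the radial
probability functions are Lipschitzian with a constant independent of the direction. -/
theorem exists_lipschitz_radialProb (hm : 1 ≤ m)
    (hgLip : LocallyLipschitz fun p : X × EuclideanSpace ℝ (Fin m) => g p.1 p.2)
    (hgConv : ∀ x : X, ConvexOn ℝ univ (g x)) {R : Matrix (Fin m) (Fin m) ℝ} (hR : R.PosDef)
    (hRL : R = L * L.transpose) (hx : g x 0 < 0)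
    (hcond : Bornology.IsBounded {z : EuclideanSpace ℝ (Fin m) | g x z ≤ 0} ∨
      ∃ l : ℝ, 0 < l ∧ niceCone g L l x = univ) :
    ∃ δ > 0, ∃ C, 0 ≤ C ∧ ∀ v, ∀ y ∈ Metric.ball x δ, ∀ y' ∈ Metric.ball x δ,
      |radialProb g L y v - radialProb g L y' v| ≤ C * ‖y - y'‖ := by
  obtain ⟨κ, hκ, hκv⟩ := exists_le_norm_toEuclideanCLM hR hRL
  set T := Matrix.toEuclideanCLM (𝕜 := ℝ) L with hT
  obtain ⟨N, M, δ₀, hN, hM, hδ₀, hfar⟩ : ∃ N M δ₀ : ℝ, 2 * (m : ℝ) ≤ N ∧ 0 ≤ M ∧ 0 < δ₀ ∧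
      ∀ v : UnitSphere m, ∀ y ∈ Metric.ball x δ₀, ∀ y' ∈ Metric.ball x δ₀,
        0 < g y' (N • T v) ∨ ∀ s, N ≤ s → g y' (s • T v) - g y (s • T v) ≤
          M * (s ^ m)⁻¹ * Real.exp (s ^ 2 / 2) * ‖y - y'‖ := by
    rcases hcond with hbdd | ⟨l, hl, hnice⟩
    · obtain ⟨B, hB⟩ := hbdd.exists_norm_le
      -- At radius `N` every ray has norm at least `|B| + 1`, hence is infeasible at `x`;
      -- compactness of the sphere extends this to a neighbourhood of `x`, uniformly in `v`.
      set N := max (2 * (m : ℝ)) ((|B| + 1) / κ) with hN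
      have hN0 : 0 < N := lt_max_of_lt_right (by positivity)
      have hpos : ∀ v : UnitSphere m, 0 < g x (N • T v) := by
        intro v
        by_contra h
        have h1 := hB _ (not_lt.1 h)
        rw [norm_smul, Real.norm_eq_abs, abs_of_pos hN0] at h1
        have h2 : |B| + 1 ≤ N * κ := (div_le_iff₀ hκ).1 (le_max_right _ _)
        have h3 : N * κ ≤ N * ‖T v‖ := by gcongr; exact hκv v
        linarith [le_abs_self B]
      have hc : Continuous fun q : X × UnitSphere m =>
          g q.1 (N • T (q.2 : EuclideanSpace ℝ (Fin m))) :=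
        hgLip.continuous.comp (by fun_prop : Continuous fun q : X × UnitSphere m =>
          (q.1, N • T (q.2 : EuclideanSpace ℝ (Fin m))))
      have hev : ∀ᶠ y in 𝓝 x, ∀ v ∈ (univ : Set (UnitSphere m)), 0 < g y (N • T v) :=
        isCompact_univ.eventually_forall_of_forall_eventually fun v _ =>
          hc.continuousAt.eventually (lt_mem_nhds (hpos v))
      obtain ⟨δ₀, hδ₀, hb⟩ := Metric.eventually_nhds_iff_ball.1 hev
      exact ⟨N, 0, δ₀, le_max_left _ _, le_rfl, hδ₀, fun v _ _ y' hy' =>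
        .inl (hb y' hy' v (mem_univ v))⟩
    · refine ⟨max (2 * (m : ℝ)) (l / κ), l * (κ ^ m)⁻¹, 1 / l, le_max_left _ _, by positivity,
        by positivity, fun v y hy y' hy' => .inr fun s hs => ?_⟩
      rw [norm_sub_rev]
      exact sub_le_of_niceCone_eq_univ hgLip hl hnice hκ (hκv v) ((le_max_right _ _).trans hs)
        (Metric.ball_subset_closedBall hy) (Metric.ball_subset_closedBall hy')
  have hN0 : 0 < N := by
    have : (1 : ℝ) ≤ m := by exact_mod_cast hm
    linarith
  obtain ⟨δ₁, hδ₁, K, hK, hlip⟩ := exists_lipschitz_of_isCompact hgLip x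
    (isCompact_closedBall (0 : EuclideanSpace ℝ (Fin m)) ((N + 1) * ‖T‖))
  set c := -g x 0 / 2 with hc
  have hc0 : 0 < c := by rw [hc]; linarith
  have hev : ∀ᶠ y in 𝓝 x, g y 0 < -c := by
    have hcont : Continuous fun w => g w 0 :=
      hgLip.continuous.comp (by fun_prop : Continuous fun w : X => (w, _))
    exact hcont.continuousAt.eventually (gt_mem_nhds (by rw [hc]; linarith))
  obtain ⟨δ₂, hδ₂, hmean⟩ := Metric.eventually_nhds_iff_ball.1 hev
  obtain ⟨D, hD, hχ⟩ := exists_chiDensity_le m (N + 1)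
  -- Two points of the ball are within `2 δ₃`, so `N (K ‖y - y'‖) ≤ c / 2`, the smallness required
  -- by `chiMeasure_real_sub_le`.
  set δ₃ := c / (4 * N * (K + 1)) with hδ₃
  have hδ₃0 : 0 < δ₃ := by positivity
  set C := D * (N * K / c) + 2 * (chiConst m * Real.exp 2 * (M / c)) with hC
  have hk := chiConst_pos hm
  refine ⟨min (min δ₀ δ₁) (min δ₂ δ₃), by positivity, C, by positivity, fun v => ?_⟩
  have key : ∀ y ∈ Metric.ball x (min (min δ₀ δ₁) (min δ₂ δ₃)),
      ∀ y' ∈ Metric.ball x (min (min δ₀ δ₁) (min δ₂ δ₃)),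
      radialProb g L y v - radialProb g L y' v ≤ C * ‖y - y'‖ := by
    intro y hy y' hy'
    simp only [Metric.mem_ball, lt_min_iff] at hy hy'
    have hdle : ‖y - y'‖ ≤ 2 * δ₃ := by
      rw [← dist_eq_norm]
      linarith [dist_triangle_right y y' x, hy.2.2, hy'.2.2]
    refine chiMeasure_real_sub_le hm (convexOn_ray hgConv y _) (convexOn_ray hgConv y' _)
      (continuous_ray hgLip y _) (continuous_ray hgLip y' _) hc0 (norm_nonneg _) hN hK hM hD
      ?_ ?_ ?_ ?_ hχ (hfar v y hy.1.1 y' hy'.1.1)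
    · simpa using (hmean y hy.2.1).le
    · simpa using (hmean y' hy'.2.1).le
    · intro s hs
      have hmem : s • T (v : EuclideanSpace ℝ (Fin m)) ∈
          Metric.closedBall (0 : EuclideanSpace ℝ (Fin m)) ((N + 1) * ‖T‖) := by
        rw [mem_closedBall_zero_iff, norm_smul, Real.norm_eq_abs, abs_of_nonneg hs.1]
        have := T.le_opNorm (v : EuclideanSpace ℝ (Fin m))
        rw [norm_eq_of_mem_sphere, mul_one] at this
        gcongr
        exact hs.2
      have := hlip _ hmem y' hy'.1.2 y hy.1.2
      rw [norm_sub_rev]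
      exact (le_abs_self _).trans this
    · calc N * (K * ‖y - y'‖) ≤ N * ((K + 1) * (2 * δ₃)) := by gcongr; linarith
        _ = c / 2 := by rw [hδ₃]; field_simp; ring
  intro y hy y' hy'
  refine abs_le.2 ⟨?_, key y hy y' hy'⟩
  have := key y' hy' y hy
  rw [norm_sub_rev] at this
  linarith

end RadialProb

end SphericRadial

theorem mainTheorem9
    {X : Type*} [NormedAddCommGroup X] [NormedSpace ℝ X] [CompleteSpace X]
    [TopologicalSpace.SeparableSpace X]
    (hrefl : Function.Surjective (NormedSpace.inclusionInDoubleDual ℝ X))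
    {m : ℕ} (hm : 1 ≤ m)
    (g : X → EuclideanSpace ℝ (Fin m) → ℝ)
    (hgLip : LocallyLipschitz (fun p : X × EuclideanSpace ℝ (Fin m) => g p.1 p.2))
    (hgConv : ∀ x : X, ConvexOn ℝ Set.univ (g x))
    (R L : Matrix (Fin m) (Fin m) ℝ)
    (hR : SphericRadial.IsCorrelationMatrix R) (hRL : R = L * L.transpose)
    {Ω : Type*} [MeasurableSpace Ω] (P : Measure Ω) [IsProbabilityMeasure P]
    (ξ : Ω → EuclideanSpace ℝ (Fin m))
    (hξ : HasLaw ξ (multivariateGaussian 0 R) P)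
    (x : X) (hx : g x 0 < 0)
    (hcond : Bornology.IsBounded {z : EuclideanSpace ℝ (Fin m) | g x z ≤ 0} ∨
      ∃ l : ℝ, 0 < l ∧ SphericRadial.niceCone g L l x = Set.univ)
    (hsingle : ∀ᵐ v ∂(SphericRadial.sphereUniform m),
      (SphericRadial.clarkeSubdiff (fun y => SphericRadial.radialProb g L y v) x).encard = 1) :
    ((∀ᵐ v ∂(SphericRadial.sphereUniform m),
        SphericRadial.StrictlyDifferentiableAt (fun y => SphericRadial.radialProb g L y v) x) ∧
      Integrable
        (fun v => SphericRadial.strictGradient (fun y => SphericRadial.radialProb g L y v) x)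
        (SphericRadial.sphereUniform m) ∧
      SphericRadial.HasStrictDerivative (SphericRadial.probFun P ξ g)
        (∫ v, SphericRadial.strictGradient (fun y => SphericRadial.radialProb g L y v) x
          ∂(SphericRadial.sphereUniform m)) x) ∧
    (FiniteDimensional ℝ X →
      (∀ᶠ y in 𝓝 x, ∀ᵐ v ∂(SphericRadial.sphereUniform m),
        (SphericRadial.clarkeSubdiff
          (fun y' => SphericRadial.radialProb g L y' v) y).encard = 1) →
      ContDiffAt ℝ 1 (SphericRadial.probFun P ξ g) x) := by
  have := SphericRadial.separableSpace_dual_of_reflexive hrefl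
  have := SphericRadial.isProbabilityMeasure_sphereUniform hm
  obtain ⟨δ, hδ, C, hC, hlip⟩ :=
    SphericRadial.exists_lipschitz_radialProb hm hgLip hgConv hR.1 hRL hx hcond
  have hφ : SphericRadial.probFun P ξ g = fun y =>
      ∫ v, SphericRadial.radialProb g L y v ∂(SphericRadial.sphereUniform m) :=
    funext (SphericRadial.probFun_eq_integral_radialProb hm hgLip hR.1.posSemidef hRL hξ)
  -- The common Lipschitz constant is inherited by small balls around each nearby `y`; the `C¹`
  -- claim needs the derivative at all these points, not only at `x`.
  have key : ∀ y ∈ Metric.ball x δ, (∀ᵐ v ∂(SphericRadial.sphereUniform m),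
        (SphericRadial.clarkeSubdiff
          (fun y' => SphericRadial.radialProb g L y' v) y).encard = 1) →
      (∀ᵐ v ∂(SphericRadial.sphereUniform m), SphericRadial.StrictlyDifferentiableAt
        (fun y' => SphericRadial.radialProb g L y' v) y) ∧
      Integrable
        (fun v => SphericRadial.strictGradient (fun y' => SphericRadial.radialProb g L y' v) y)
        (SphericRadial.sphereUniform m) ∧
      SphericRadial.HasStrictDerivative (SphericRadial.probFun P ξ g)
        (∫ v, SphericRadial.strictGradient (fun y' => SphericRadial.radialProb g L y' v) y
          ∂(SphericRadial.sphereUniform m)) y := by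
    intro y hy hs
    obtain ⟨δ', hδ', hsub⟩ := Metric.isOpen_iff.1 Metric.isOpen_ball y hy
    have hlip' : ∀ v, ∀ z ∈ Metric.ball y δ', ∀ z' ∈ Metric.ball y δ',
        |SphericRadial.radialProb g L z v - SphericRadial.radialProb g L z' v| ≤
          C * ‖z - z'‖ := fun v z hz z' hz' => hlip v z (hsub hz) z' (hsub hz')
    refine ⟨(SphericRadial.ae_hasStrictDerivative hδ' hlip' hs).mono fun v hv => ⟨_, hv⟩, ?_⟩
    rw [hφ]
    exact SphericRadial.hasStrictDerivative_integral hδ' hC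
      (SphericRadial.measurable_radialProb hm hgLip)
      (SphericRadial.integrable_radialProb hm hgLip) hlip' hs
  refine ⟨key x (Metric.mem_ball_self hδ) hsingle, fun _ hev => ?_⟩
  refine SphericRadial.contDiffAt_one_of_eventually_hasStrictFDerivAt
    (f' := fun y => ∫ v, SphericRadial.strictGradient
      (fun y' => SphericRadial.radialProb g L y' v) y ∂(SphericRadial.sphereUniform m)) ?_
  filter_upwards [hev, Metric.ball_mem_nhds x hδ] with y hy hyb
  exact (key y hyb hy).2.2.hasStrictFDerivAt
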